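/- Let $D$ be a diagram of a knot (crossingless diagrams allowed) with writhe $w(D)$. Its Kauffman bracket is $$\langle D\rangle=\sum_s A^{\alpha(s)-\beta(s)}(-A^2-A^{-2})^{d(s)-1},$$ where $s$ runs over all choices of an $A$- or $B$-splicing at each crossing, $\alpha(s)$ and $\beta(s)$ are the numbers of $A$- and $B$-splicings in $s$, and $d(s)$ is the number of resulting circles; the same formula is used for link diagrams, including the empty one. Let $D^i$ be the blackboard $i$-cabling of $D$ (with $D^0$ empty), let $S_0=1$, $S_1=x$, $S_{m+1}=xS_m-S_{m-1}$, and if $S_m=\sum_i c_i x^i$ put $\langle S_m(D)\rangle=\sum_i c_i\langle D^i\rangle$. Let $[n]=\dfrac{A^{2n}-A^{-2n}}{A^2-A^{-2}}$. The colored Jones polynomial and its normalized version are $$J_D(m+1)=\left[(-1)^mA^{m^2+2m}\right]^{-w(D)}(-1)^{m-1}\,[2]\,\langle S_m(D)\rangle ,\qquad J'_D(n)=J_D(n)/[n],$$ where $J'_D(n)$ is regarded as an element of the field $\mathbb{Q}(A)$, whose elements have a degree in $A$ (degree of the numerator minus degree of the denominator). The $A$-graph $A(D)$ has as vertices the circles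 of the all-$A$ state and one edge for each crossing, joining the circles that meet there; $D$ is $A$-adequate if $A(D)$ has no loops; the reduced graph $A(D)'$ is obtained from $A(D)$ by replacing multiple edges by single ones. **Theorem.** Let $D$ be an $A$-adequate knot diagram. Then for every color $n\ge 2$ there are integers $a_n,b_n,k_n$ such that $$J'_D(n)=a_nA^{k_n}+b_nA^{k_n-4}+\text{terms of degree less than } k_n-4,$$ where the remaining part is zero or has degree less than $k_n-4$, and $$|a_n|=1,\qquad |b_n|=\beta_1(A(D)'),$$ where $\beta_1(A(D)')$ is the first Betti number of the graph $A(D)'$. -/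

import Mathlib

/-! ## First Betti number of a finite graph -/

/-- The space `H₁(G; ℚ)` of rational 1-cycles of a finite graph. A 1-chain is an antisymmetric
function `f` on ordered pairs of vertices that vanishes off the edges (`f u v` is the coefficient
of the edge `uv` directed from `u` to `v`), and it is a cycle if its boundary vanishes at every
vertex. -/
noncomputable def SimpleGraph.cycleSpaceQ {V : Type*} [Finite V] (G : SimpleGraph V) :
    Submodule ℚ (V → V → ℚ) where
  carrier := {f | (∀ u v, f u v = - f v u) ∧ (∀ u v, ¬ G.Adj u v → f u v = 0) ∧
    ∀ u, ∑ᶠ v, f u v = 0}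
  zero_mem' := by simp
  add_mem' := by
    rintro f g ⟨hf1, hf2, hf3⟩ ⟨hg1, hg2, hg3⟩
    refine ⟨fun u v => ?_, fun u v h => ?_, fun u => ?_⟩
    · simp only [Pi.add_apply]
      rw [hf1 u v, hg1 u v]
      ring
    · simp [hf2 u v h, hg2 u v h]
    · simp only [Pi.add_apply]
      rw [finsum_add_distrib (Set.toFinite _) (Set.toFinite _), hf3, hg3, add_zero]
  smul_mem' := by
    rintro c f ⟨hf1, hf2, hf3⟩
    refine ⟨fun u v => ?_, fun u v h => ?_, fun u => ?_⟩
    · simp only [Pi.smul_apply, smul_eq_mul]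
      rw [hf1 u v]
      ring
    · simp [hf2 u v h]
    · simp only [Pi.smul_apply]
      rw [← smul_finsum, hf3, smul_zero]

/-- The first Betti number `β₁(G) = dim H₁(G; ℚ)` of a finite graph. -/
noncomputable def SimpleGraph.bettiOne {V : Type*} [Finite V] (G : SimpleGraph V) : ℕ :=
  Module.finrank ℚ G.cycleSpaceQ

/-! ## Link diagrams -/

/-- An unoriented link diagram (in combinatorial form, as in a planar diagram code) with set of
crossings `X`. The four half-edges at a crossing `x` are `(x, 0), (x, 1), (x, 2), (x, 3)`, in
counterclockwise order, where `(x, 0)` and `(x, 2)` belong to the underpassing strand and `(x, 1)`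
and `(x, 3)` to the overpassing strand. The involution `edge` sends a half-edge to the other half
of its edge, and `loops` is the number of circles of the diagram without crossings.
Planarity is the separate predicate `LinkDiagram.IsPlanar`. -/
structure LinkDiagram (X : Type*) where
  loops : ℕ
  edge : X × Fin 4 → X × Fin 4
  edge_edge : ∀ d, edge (edge d) = d
  edge_ne : ∀ d, edge d ≠ d

namespace LinkDiagram

variable {X : Type*} (D : LinkDiagram X)

/-- The faces of the (crossing part of the) diagram: the orbits of "follow the edge to its other
end, then take the next half-edge counterclockwise". -/
abbrev Face : Type _ :=
  Quot fun d e : X × Fin 4 => e = ((D.edge d).1, (D.edge d).2 + 1)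

/-- The connected components of the underlying 4-valent graph (crossingless circles excluded). -/
abbrev GraphComponent : Type _ :=
  Quot fun d e : X × Fin 4 => e.1 = d.1 ∨ e = D.edge d

/-- The diagram is planar (drawn on the sphere, or equivalently in the plane). This is Euler's
formula `V - E + F = 2C` for the 4-valent map with `V` vertices, `E = 2V` edges, `F` faces and `C`
connected components. -/
def IsPlanar : Prop :=
  Nat.card D.Face = Nat.card X + 2 * Nat.card D.GraphComponent

/-- The components of the link: go along edges, and straight across crossings. -/
abbrev LinkComponent : Type _ :=
  (Quot fun d e : X × Fin 4 => e = D.edge d ∨ e = (d.1, d.2 + 2)) ⊕ Fin D.loops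

/-- A knot diagram: a planar link diagram with exactly one component. -/
def IsKnotDiagram : Prop :=
  D.IsPlanar ∧ Nat.card D.LinkComponent = 1

/-! ## States, Kauffman bracket, A-graph -/

/-- How a splicing connects the four half-edges at a crossing. The `A`-splicing (`true`) opens the
channel between the two regions swept out by the overpassing strand when it is turned
counterclockwise until it meets the underpassing one, so it connects `0` with `1` and `2`
with `3`; the `B`-splicing (`false`) connects `1` with `2` and `3` with `0`. -/
def splice : Bool → Fin 4 → Fin 4
  | true => ![1, 0, 3, 2]
  | false => ![3, 2, 1, 0]

/-- The circles obtained by splicing every crossing according to the state `s`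
(`s x = true` for an `A`-splicing at `x`, `s x = false` for a `B`-splicing). -/
abbrev Circle (s : X → Bool) : Type _ :=
  (Quot fun d e : X × Fin 4 => e = D.edge d ∨ e = (d.1, splice (s d.1) d.2)) ⊕ Fin D.loops

/-- The circle of the state `s` that passes through the half-edge `d`. -/
def circleAt (s : X → Bool) (d : X × Fin 4) : D.Circle s :=
  Sum.inl (Quot.mk _ d)

/-- The Kauffman bracket `⟨D⟩ = ∑ₛ A^(α(s) - β(s)) (-A² - A⁻²)^(d(s) - 1)`, as an element of the
field `ℚ(A)` (the empty diagram has bracket `(-A² - A⁻²)⁻¹`). -/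
noncomputable def bracket [Fintype X] [DecidableEq X] : RatFunc ℚ :=
  ∑ s : X → Bool,
    RatFunc.X ^ ((Nat.card {x // s x = true} : ℤ) - (Nat.card {x // s x = false} : ℤ)) *
      (-RatFunc.X ^ (2 : ℤ) - RatFunc.X ^ (-2 : ℤ)) ^ ((Nat.card (D.Circle s) : ℤ) - 1)

/-- The `A`-graph `A(D)`, a multigraph: its vertices are the circles of the all-`A` state, and every
crossing `x` is an edge joining the two circles that meet the two arcs of the `A`-splicing
at `x`. -/
def aGraph : Graph (D.Circle fun _ => true) X where
  vertexSet := Set.univ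
  IsLink x u v :=
    s(u, v) = s(D.circleAt (fun _ => true) (x, 0), D.circleAt (fun _ => true) (x, 2))
  isLink_symm := fun x _ => ⟨fun u v h => by rw [Sym2.eq_swap]; exact h⟩
  eq_or_eq_of_isLink_of_isLink := by
    intro x u v u' v' h h'
    have h2 := h.trans h'.symm
    rw [Sym2.eq_iff] at h2
    tauto
  left_mem_of_isLink := fun _ _ _ _ => Set.mem_univ _

/-- `D` is `A`-adequate if its `A`-graph has no loops. -/
def IsAAdequate : Prop := D.aGraph.Loopless

/-- The reduced `A`-graph `A(D)'`: the vertices of `A(D)`, with multiple edges reduced to single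
ones. (There are no loops to consider when `D` is `A`-adequate.) -/
def reducedAGraph : SimpleGraph (D.Circle fun _ => true) where
  Adj u v := u ≠ v ∧ D.aGraph.Adj u v
  symm := ⟨fun _ _ h => ⟨h.1.symm, h.2.symm⟩⟩
  loopless := ⟨fun _ h => h.1 rfl⟩

/-! ## Blackboard cablings -/

/-- A quarter turn of the `n × n` grid changes `(a, b)` into `(b, n - 1 - a)`; this is the
`i`-fold quarter turn. -/
def turn {n : ℕ} (i : Fin 4) (c : Fin n × Fin n) : Fin n × Fin n :=
  match i with
  | 0 => (c.1, c.2)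
  | 1 => (c.2, c.1.rev)
  | 2 => (c.1.rev, c.2.rev)
  | 3 => (c.2.rev, c.1)

/-- In the `n`-cable every crossing `x` becomes an `n × n` grid of crossings `(x, a, b)`, where `a`
numbers the parallel underpassing strands and `b` the parallel overpassing strands: with half-edge
`0` at the bottom, `a` grows from left to right and `b` from bottom to top. The half-edge
`((x, a, b), i)` gets the coordinates `((x, i), (p, q))`, where `p` is the number of its strand
among the `n` strands leaving the grid at side `i` (numbered counterclockwise around `x`), and `q`
is the number of grid crossings that lie between it and side `i`. -/
def cableCoord (X : Type*) (n : ℕ) :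
    (X × Fin n × Fin n) × Fin 4 ≃ (X × Fin 4) × (Fin n × Fin n) where
  toFun d := ((d.1.1, d.2), turn d.2 d.1.2)
  invFun d := ((d.1.1, turn (-d.1.2) d.2), d.1.2)
  left_inv := by
    rintro ⟨⟨x, a, b⟩, i⟩
    have h1 : (-1 : Fin 4) = 3 := rfl
    have h2 : (-2 : Fin 4) = 2 := rfl
    have h3 : (-3 : Fin 4) = 1 := rfl
    fin_cases i <;> simp [turn, h1, h2, h3]
  right_inv := by
    rintro ⟨⟨x, i⟩, a, b⟩
    have h1 : (-1 : Fin 4) = 3 := rfl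
    have h2 : (-2 : Fin 4) = 2 := rfl
    have h3 : (-3 : Fin 4) = 1 := rfl
    fin_cases i <;> simp [turn, h1, h2, h3]

/-- The edges of the `n`-cable in the above coordinates. At the border of a grid (`q = 0`) follow
the corresponding parallel copy of the edge of `D`; this reverses the counterclockwise numbering of
the strands. Otherwise go to the neighbouring crossing of the grid, and arrive there from the
opposite side. -/
def cableStep (n : ℕ) (d : (X × Fin 4) × (Fin n × Fin n)) : (X × Fin 4) × (Fin n × Fin n) :=
  if h : d.2.2.val = 0 then (D.edge d.1, (d.2.1.rev, d.2.2))
  else ((d.1.1, d.1.2 + 2), (d.2.1.rev, ⟨n - d.2.2.val, by have := d.2.2.isLt; omega⟩))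

theorem fin4_add_two_add_two (i : Fin 4) : i + 2 + 2 = i := by
  fin_cases i <;> rfl

theorem fin4_add_two_ne (i : Fin 4) : i + 2 ≠ i := by
  fin_cases i <;> decide

theorem cableStep_cableStep (n : ℕ) (d : (X × Fin 4) × (Fin n × Fin n)) :
    D.cableStep n (D.cableStep n d) = d := by
  obtain ⟨⟨x, i⟩, p, q, hq⟩ := d
  by_cases h : q = 0
  · simp [cableStep, h, D.edge_edge]
  · have h1 : n - q ≠ 0 := by omega
    have h2 : n - (n - q) = q := by omega
    simp [cableStep, h, h1, h2, fin4_add_two_add_two]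

theorem cableStep_ne (n : ℕ) (d : (X × Fin 4) × (Fin n × Fin n)) : D.cableStep n d ≠ d := by
  obtain ⟨⟨x, i⟩, p, q, hq⟩ := d
  by_cases h : q = 0
  · intro hd
    simp only [cableStep, h] at hd
    exact D.edge_ne _ (congrArg Prod.fst hd)
  · intro hd
    simp only [cableStep, h, dite_false] at hd
    exact fin4_add_two_ne i (congrArg (fun e => e.1.2) hd)

/-- The blackboard `n`-cabling `Dⁿ`: every strand is replaced by `n` parallel copies of itself in
the plane. `D⁰` is the empty diagram. -/
def cable (n : ℕ) : LinkDiagram (X × Fin n × Fin n) where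
  loops := n * D.loops
  edge d := (cableCoord X n).symm (D.cableStep n (cableCoord X n d))
  edge_edge d := by simp [cableStep_cableStep]
  edge_ne d h := D.cableStep_ne n (cableCoord X n d) ((Equiv.symm_apply_eq _).1 h)

/-! ## The colored Jones polynomial -/

open Classical in
/-- The sign of a crossing of a knot diagram. Orient the knot so that it enters `x` through the
half-edge `(x, 0)`; the crossing is positive iff the overpassing strand then enters through
`(x, 3)`, i.e. iff one gets from entering at `(x, 0)` to entering at `(x, 3)` by travelling along
the knot. For a knot this does not depend on the choice of orientation. -/
noncomputable def crossingSign (x : X) : ℤ :=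
  let r : X × Fin 4 → X × Fin 4 → Prop := fun d e => e = D.edge (d.1, d.2 + 2)
  if Quot.mk r (x, 0) = Quot.mk r (x, 3) then 1 else -1

variable [Fintype X]

/-- The writhe `w(D)` of a knot diagram. -/
noncomputable def writhe : ℤ := ∑ x, D.crossingSign x

variable [DecidableEq X]

/-- `⟨Sₘ(D)⟩`: the bracket of the linear combination of blackboard cablings that is obtained by
substituting `D` in the polynomial `Sₘ`, where `S₀ = 1`, `S₁ = x`, `Sₘ₊₁ = x Sₘ - Sₘ₋₁`. -/
noncomputable def chebyshevBracket (m : ℕ) : RatFunc ℚ :=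
  (Polynomial.Chebyshev.S ℤ m).sum fun i c => (c : RatFunc ℚ) * (D.cable i).bracket

/-- The quantum integer `[n] = (A²ⁿ - A⁻²ⁿ) / (A² - A⁻²)`. -/
noncomputable def quantumInt (n : ℕ) : RatFunc ℚ :=
  (RatFunc.X ^ (2 * n : ℤ) - RatFunc.X ^ (-(2 * n) : ℤ)) /
    (RatFunc.X ^ (2 : ℤ) - RatFunc.X ^ (-2 : ℤ))

/-- The colored Jones polynomial of the knot with diagram `D` in the color `m + 1`:
`J(m + 1) = ((-1)ᵐ A^(m² + 2m))^(-w(D)) (-1)^(m - 1) [2] ⟨Sₘ(D)⟩`. -/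
noncomputable def coloredJonesSucc (m : ℕ) : RatFunc ℚ :=
  ((-1) ^ m * RatFunc.X ^ (m ^ 2 + 2 * m)) ^ (-D.writhe) * (-1) ^ ((m : ℤ) - 1) *
    quantumInt 2 * D.chebyshevBracket m

/-- The normalized colored Jones polynomial `J'(m + 1) = J(m + 1) / [m + 1]`. -/
noncomputable def normalizedColoredJonesSucc (m : ℕ) : RatFunc ℚ :=
  D.coloredJonesSucc m / quantumInt (m + 1)

end LinkDiagram

/-! Let δ = -A² - A⁻² and let c be the number of crossings. For a set S of crossings let d(S) be the
number of circles of the state with B-splicings exactly on S, and v = d(∅). The term of S in the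
bracket has leading degree c - 2|S| + 2(d(S) - 1). In a planar diagram one switch changes d by
exactly one, so this degree never rises as S grows. If D is A-adequate, the first switch merges two
circles and the degree drops by 4. The total drop is exactly 4 when all crossings in S are parallel
edges of A(D), because every later switch then splits a circle
(`IsHomPlanar.circleCount_of_parallel`); otherwise it is at least 8
(`IsCheckerboard.circleCount_of_not_parallel`). Relative to the leading sign, the nonempty subsets
of one parallel class contribute -1 in total. So the second coefficient of the bracket is ±(v - 1 -
e'), where v - 1 comes from expanding δ^(v-1) and e' is the number of edges of A(D)'
(`IsHomPlanar.expands_bracket`). For a knot A(D)' is connected, hence this is β₁(A(D)') up to sign.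

If D has crossings, its blackboard cables are again planar and A-adequate. In the n-cable, n ≥ 1,
every A-circle becomes n parallel copies. The reduced graph keeps the e' old edges, between copies
of different circles, and gains a chain of n - 1 edges through the copies of each circle. So v - e'
does not depend on n (`IsCheckerboard.aCircleCount_cable`, `IsHomPlanar.card_image_aEdge_cable`).
The lower cables in S_m(D) have degree too small to matter, [2]/[n] has no second term, and the
other normalizing factors form a signed power of A. Without crossings, J' is ±1.

Planarity is given by Euler's formula and used in homological form: every 1-cycle mod 2 bounds a set
of faces (`isHomPlanar_of_card_le`). This yields a checkerboard colouring and two sides for every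
state circle, and hence that parallel crossings lie on the same side of their circles and are not
interlaced. -/

/-! ## Quotients by a relation and one additional pair -/

section Merge

open Relation

variable {α : Type*} {r : α → α → Prop} {a b : α}

/-- The relation `r` together with the pair `(a, b)`. -/
def mergeRel (r : α → α → Prop) (a b : α) : α → α → Prop := fun x y => r x y ∨ (x = a ∧ y = b)

theorem _root_.Relation.EqvGen.mono_mergeRel {x y : α} (h : EqvGen r x y) : EqvGen (mergeRel r a b) x y :=
  h.mono fun _ _ h => Or.inl h

theorem eqvGen_mergeRel_pair : EqvGen (mergeRel r a b) a b := .rel _ _ (Or.inr ⟨rfl, rfl⟩)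

theorem eqvGen_mergeRel_iff {x y : α} : EqvGen (mergeRel r a b) x y ↔
    EqvGen r x y ∨ (EqvGen r x a ∧ EqvGen r y b) ∨ (EqvGen r x b ∧ EqvGen r y a) := by
  constructor
  · intro h
    induction h with
    | rel x y h =>
      rcases h with h | ⟨rfl, rfl⟩
      · exact Or.inl (.rel _ _ h)
      · exact Or.inr (Or.inl ⟨.refl _, .refl _⟩)
    | refl x => exact Or.inl (.refl _)
    | symm x y _ ih =>
      rcases ih with h | h | h
      · exact Or.inl h.symm
      · exact Or.inr (Or.inr h.symm)
      · exact Or.inr (Or.inl h.symm)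
    | trans x y z _ _ ih1 ih2 =>
      rcases ih1 with h1 | ⟨h1, h1'⟩ | ⟨h1, h1'⟩ <;> rcases ih2 with h2 | ⟨h2, h2'⟩ | ⟨h2, h2'⟩
      · exact Or.inl (h1.trans _ _ _ h2)
      · exact Or.inr (Or.inl ⟨h1.trans _ _ _ h2, h2'⟩)
      · exact Or.inr (Or.inr ⟨h1.trans _ _ _ h2, h2'⟩)
      · exact Or.inr (Or.inl ⟨h1, h2.symm.trans _ _ _ h1'⟩)
      · exact Or.inl (h1.trans _ _ _ (h2.symm.trans _ _ _ (h1'.trans _ _ _ h2'.symm)))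
      · exact Or.inl (h1.trans _ _ _ h2'.symm)
      · exact Or.inr (Or.inr ⟨h1, h2.symm.trans _ _ _ h1'⟩)
      · exact Or.inl (h1.trans _ _ _ h2'.symm)
      · exact Or.inl (h1.trans _ _ _ (h2.symm.trans _ _ _ (h1'.trans _ _ _ h2'.symm)))
  · rintro (h | ⟨h1, h2⟩ | ⟨h1, h2⟩)
    · exact h.mono_mergeRel
    · exact h1.mono_mergeRel.trans _ _ _
        (eqvGen_mergeRel_pair.trans _ _ _ h2.mono_mergeRel.symm)
    · exact h1.mono_mergeRel.trans _ _ _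
        (eqvGen_mergeRel_pair.symm.trans _ _ _ h2.mono_mergeRel.symm)

theorem card_quot_eq_of_eqvGen_iff {r r' : α → α → Prop}
    (h : ∀ x y, EqvGen r x y ↔ EqvGen r' x y) : Nat.card (Quot r) = Nat.card (Quot r') :=
  Nat.card_congr
    { toFun := Quot.lift (Quot.mk r') fun x y hxy => Quot.eqvGen_sound ((h x y).1 (.rel _ _ hxy))
      invFun := Quot.lift (Quot.mk r) fun x y hxy => Quot.eqvGen_sound ((h x y).2 (.rel _ _ hxy))
      left_inv := by rintro ⟨x⟩; rfl
      right_inv := by rintro ⟨x⟩; rfl }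

/-- The classes of `r` other than that of `a` correspond bijectively to the classes after merging,
since the class of `b` stands for both. -/
theorem card_quot_of_not_eqvGen [Finite α] (h : ¬ EqvGen r a b) :
    Nat.card (Quot r) = Nat.card (Quot (mergeRel r a b)) + 1 := by
  classical
  let f : {q : Quot r // q ≠ Quot.mk r a} → Quot (mergeRel r a b) :=
    fun q => Quot.lift (Quot.mk _) (fun x y hxy => Quot.sound (Or.inl hxy)) q.1
  have hf : f.Bijective := by
    constructor
    · rintro ⟨⟨x⟩, hx⟩ ⟨⟨y⟩, hy⟩ hxy
      have hx' : ¬ EqvGen r x a := fun h => hx (Quot.eqvGen_sound h)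
      have hy' : ¬ EqvGen r y a := fun h => hy (Quot.eqvGen_sound h)
      rcases eqvGen_mergeRel_iff.1 (Quot.eqvGen_exact hxy) with h | h | h
      · exact Subtype.ext (Quot.eqvGen_sound h)
      · exact absurd h.1 hx'
      · exact absurd h.2 hy'
    · rintro ⟨x⟩
      by_cases hx : EqvGen r x a
      · refine ⟨⟨Quot.mk r b, fun hb => h (Quot.eqvGen_exact hb).symm⟩, ?_⟩
        exact Quot.eqvGen_sound
          (eqvGen_mergeRel_pair.symm.trans _ _ _ hx.mono_mergeRel.symm)
      · exact ⟨⟨Quot.mk r x, fun h => hx (Quot.eqvGen_exact h)⟩, rfl⟩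
  rw [← Nat.card_congr (Equiv.ofBijective f hf), ← Finite.card_option]
  exact Nat.card_congr (Equiv.optionSubtypeNe _).symm

theorem card_quot_of_eqvGen (h : EqvGen r a b) :
    Nat.card (Quot r) = Nat.card (Quot (mergeRel r a b)) := by
  refine card_quot_eq_of_eqvGen_iff fun x y => ⟨fun h => h.mono_mergeRel, fun h' => ?_⟩
  rcases eqvGen_mergeRel_iff.1 h' with h1 | ⟨h1, h2⟩ | ⟨h1, h2⟩
  · exact h1
  · exact h1.trans _ _ _ (h.trans _ _ _ h2.symm)
  · exact h1.trans _ _ _ (h.symm.trans _ _ _ h2.symm)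

theorem eqvGen_apply_eq {β : Type*} {f : α → β} (hf : ∀ x y, r x y → f x = f y) {x y : α}
    (h : EqvGen r x y) : f x = f y :=
  congrArg (Quot.lift f hf) (Quot.eqvGen_sound h)

end Merge

/-! ## Circles of states, and how they change when one splicing is switched -/

namespace LinkDiagram

open Relation

variable {X : Type*} (D : LinkDiagram X)

theorem splice_splice (b : Bool) (i : Fin 4) : splice b (splice b i) = i := by
  revert b i; decide

theorem splice_ne (b : Bool) (i : Fin 4) : splice b i ≠ i := by
  revert b i; decide

/-- The relation whose classes are the circles of the state `s` that pass through crossings. -/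
def stateRel (s : X → Bool) : X × Fin 4 → X × Fin 4 → Prop :=
  fun d e => e = D.edge d ∨ e = (d.1, splice (s d.1) d.2)

/-- Two half-edges are on the same circle of the state `s`. -/
abbrev SameCircle (s : X → Bool) : X × Fin 4 → X × Fin 4 → Prop := EqvGen (D.stateRel s)

variable {D} {s s' : X → Bool} {x : X} {d e : X × Fin 4}

theorem circleAt_eq_iff : D.circleAt s d = D.circleAt s e ↔ D.SameCircle s d e :=
  ⟨fun h => Quot.eqvGen_exact (Sum.inl_injective h),
    fun h => congrArg Sum.inl (Quot.eqvGen_sound h)⟩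

theorem card_circle [Finite X] : Nat.card (D.Circle s) = Nat.card (Quot (D.stateRel s)) + D.loops := by
  have : Finite (Quot (D.stateRel s)) := inferInstance
  have h : Nat.card (D.Circle s) = Nat.card (Quot (D.stateRel s) ⊕ Fin D.loops) := rfl
  rw [h, Nat.card_sum, Nat.card_fin]

theorem sameCircle_edge (s : X → Bool) (d : X × Fin 4) : D.SameCircle s d (D.edge d) :=
  .rel _ _ (Or.inl rfl)

theorem sameCircle_splice (s : X → Bool) (x : X) (i : Fin 4) :
    D.SameCircle s (x, i) (x, splice (s x) i) := .rel _ _ (Or.inr rfl)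

theorem sameCircle_splice' {b : Bool} (h : s x = b) (i : Fin 4) :
    D.SameCircle s (x, i) (x, splice b i) := h ▸ sameCircle_splice s x i

theorem SameCircle.apply_eq {β : Type*} {f : X × Fin 4 → β} (h1 : ∀ d, f (D.edge d) = f d)
    (h2 : ∀ x i, f (x, splice (s x) i) = f (x, i)) (h : D.SameCircle s d e) : f d = f e :=
  eqvGen_apply_eq (fun d e h => by
    rcases h with rfl | rfl
    · exact (h1 d).symm
    · exact (h2 d.1 d.2).symm) h

/-- Either splicing pairs 0 and 2 with the other two half-edges. Once 0 and 2 are identified, all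
four at `x` are, and the splicing at `x` is forgotten: two states differing only at `x` have this
common quotient. -/
theorem eqvGen_mergeRel_crossing (s : X → Bool) (x : X) (i : Fin 4) :
    EqvGen (mergeRel (D.stateRel s) (x, 0) (x, 2)) (x, 0) (x, i) := by
  have h02 : EqvGen (mergeRel (D.stateRel s) (x, 0) (x, 2)) (x, 0) (x, 2) := eqvGen_mergeRel_pair
  cases h : s x
  · have h0 := (sameCircle_splice' (D := D) h 0).mono_mergeRel (a := (x, 0)) (b := (x, 2))
    have h2 := (sameCircle_splice' (D := D) h 2).mono_mergeRel (a := (x, 0)) (b := (x, 2))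
    fin_cases i
    · exact .refl _
    · exact h02.trans _ _ _ h2
    · exact h02
    · exact h0
  · have h0 := (sameCircle_splice' (D := D) h 0).mono_mergeRel (a := (x, 0)) (b := (x, 2))
    have h2 := (sameCircle_splice' (D := D) h 2).mono_mergeRel (a := (x, 0)) (b := (x, 2))
    fin_cases i
    · exact .refl _
    · exact h0
    · exact h02
    · exact h02.trans _ _ _ h2

theorem eqvGen_mergeRel_of_agree (hs : ∀ y ≠ x, s y = s' y)
    (h : EqvGen (mergeRel (D.stateRel s) (x, 0) (x, 2)) d e) :
    EqvGen (mergeRel (D.stateRel s') (x, 0) (x, 2)) d e := by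
  refine Quot.eqvGen_exact (eqvGen_apply_eq (f := Quot.mk _) (fun d e hde => ?_) h)
  apply Quot.eqvGen_sound
  obtain ⟨y, i⟩ := d
  rcases hde with (rfl | rfl) | ⟨h1, h2⟩
  · exact (sameCircle_edge s' _).mono_mergeRel
  · by_cases hy : y = x
    · subst hy
      exact (eqvGen_mergeRel_crossing s' y i).symm.trans _ _ _ (eqvGen_mergeRel_crossing s' y _)
    · simp only [hs y hy]
      exact (sameCircle_splice s' y i).mono_mergeRel
  · rw [h1, h2]
    exact eqvGen_mergeRel_pair

theorem mergeRel_iff_of_agree (hs : ∀ y ≠ x, s y = s' y) (d e : X × Fin 4) :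
    EqvGen (mergeRel (D.stateRel s) (x, 0) (x, 2)) d e ↔
      EqvGen (mergeRel (D.stateRel s') (x, 0) (x, 2)) d e :=
  ⟨eqvGen_mergeRel_of_agree hs, eqvGen_mergeRel_of_agree fun y hy => (hs y hy).symm⟩

/-- The effect of changing the state at `x` only, on pairs of half-edges. -/
theorem sameCircle_switch (hs : ∀ y ≠ x, s y = s' y) (h : D.SameCircle s d e) :
    D.SameCircle s' d e ∨ (D.SameCircle s' d (x, 0) ∧ D.SameCircle s' e (x, 2)) ∨
      (D.SameCircle s' d (x, 2) ∧ D.SameCircle s' e (x, 0)) :=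
  eqvGen_mergeRel_iff.1 (eqvGen_mergeRel_of_agree hs h.mono_mergeRel)

theorem sameCircle_of_switch (hs : ∀ y ≠ x, s y = s' y) (h' : D.SameCircle s' (x, 0) (x, 2))
    (h : D.SameCircle s d e) : D.SameCircle s' d e := by
  rcases sameCircle_switch hs h with h | ⟨h1, h2⟩ | ⟨h1, h2⟩
  · exact h
  · exact h1.trans _ _ _ (h'.trans _ _ _ h2.symm)
  · exact h1.trans _ _ _ (h'.symm.trans _ _ _ h2.symm)

/-- If the two arcs of the splicing at `x` are on different circles, then switching it merges
these circles. -/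
theorem sameCircle_switch_of_not [Finite X] (hs : ∀ y ≠ x, s y = s' y) (hx : s x ≠ s' x)
    (h : ¬ D.SameCircle s (x, 0) (x, 2)) : D.SameCircle s' (x, 0) (x, 2) := by
  classical
  -- Parity argument, valid without planarity. Suppose the arcs were separate in both states, and
  -- let `K` be the set of half-edges on the circle of `(x, 0)` in both. At `x` it contains only
  -- `(x, 0)`. The edge involution makes |K| even, while splicing away from `x` makes |K \ {(x, 0)}|
  -- even.
  by_contra h'
  have := Fintype.ofFinite X
  let K : Finset (X × Fin 4) :=
    {d | D.SameCircle s d (x, 0) ∧ D.SameCircle s' d (x, 0)}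
  have hK : ∀ d, d ∈ K ↔ D.SameCircle s d (x, 0) ∧ D.SameCircle s' d (x, 0) := fun d => by
    simp [K]
  have hxK : ∀ i, (x, i) ∈ K → i = 0 := by
    intro i hi
    obtain ⟨h1, h2⟩ := (hK _).1 hi
    have a0 := sameCircle_splice (D := D) s x 2
    have b0 := sameCircle_splice (D := D) s' x 2
    cases e1 : s x <;> cases e2 : s' x <;> simp [e1, e2] at hx <;> rw [e1] at a0 <;>
      rw [e2] at b0 <;> fin_cases i <;> first
        | rfl
        | exact absurd h1.symm h
        | exact absurd h2.symm h'
        | exact absurd ((a0.trans _ _ _ h1).symm) h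
        | exact absurd ((b0.trans _ _ _ h2).symm) h'
  have h0K : (x, 0) ∈ K := (hK _).2 ⟨.refl _, .refl _⟩
  have c1 : ∑ d ∈ K, (1 : ZMod 2) = 0 := by
    refine Finset.sum_involution (fun d _ => D.edge d) (fun _ _ => by decide)
      (fun d _ _ => D.edge_ne d) (fun d hd => ?_) (fun d _ => D.edge_edge d)
    obtain ⟨h1, h2⟩ := (hK _).1 hd
    exact (hK _).2 ⟨(sameCircle_edge s d).symm.trans _ _ _ h1,
      (sameCircle_edge s' d).symm.trans _ _ _ h2⟩
  have c2 : ∑ d ∈ K.erase (x, 0), (1 : ZMod 2) = 0 := by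
    refine Finset.sum_involution (fun d _ => (d.1, splice (s d.1) d.2)) (fun _ _ => by decide)
      (fun d _ _ hd => splice_ne _ _ (congrArg Prod.snd hd)) (fun d hd => ?_)
      (fun d _ => by simp [splice_splice])
    obtain ⟨y, i⟩ := d
    obtain ⟨hne, hd⟩ := Finset.mem_erase.1 hd
    obtain ⟨h1, h2⟩ := (hK _).1 hd
    have hy : y ≠ x := by
      rintro rfl
      exact hne (by rw [hxK i hd])
    refine Finset.mem_erase.2 ⟨fun h => hy (congrArg Prod.fst h), (hK _).2
      ⟨(sameCircle_splice s y i).symm.trans _ _ _ h1, ?_⟩⟩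
    simp only [hs y hy]
    exact (sameCircle_splice s' y i).symm.trans _ _ _ h2
  rw [← Finset.sum_erase_add _ _ h0K, c2] at c1
  exact absurd c1 (by decide)

/-- A checkerboard colouring of the corners of a diagram: `c d` is the colour of the corner
clockwise of the half-edge `d`. -/
structure IsCheckerboard (D : LinkDiagram X) (c : X × Fin 4 → ZMod 2) : Prop where
  edge : ∀ d, c (D.edge d) = c d + 1
  turn : ∀ x i, c (x, i + 1) = c (x, i) + 1

/-- Both splicings join neighbouring half-edges. So colours alternate along every state circle, and
the half-edges of one colour give the circle a direction of travel. -/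
theorem IsCheckerboard.splice {c : X × Fin 4 → ZMod 2} (hc : D.IsCheckerboard c) (b : Bool) (x : X)
    (i : Fin 4) : c (x, splice b i) = c (x, i) + 1 := by
  have h0 : c (x, 1) = c (x, 0) + 1 := hc.turn x 0
  have h1 : c (x, 2) = c (x, 1) + 1 := hc.turn x 1
  have h2 : c (x, 3) = c (x, 2) + 1 := hc.turn x 2
  cases b <;> fin_cases i <;> simp [LinkDiagram.splice, h0, h1, h2, add_assoc] <;> decide

/-- In a checkerboard colourable diagram, if the two arcs of the splicing at `x` are on the same
circle, then switching it splits this circle. -/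
theorem IsCheckerboard.not_sameCircle_switch [Finite X] {c : X × Fin 4 → ZMod 2}
    (hc : D.IsCheckerboard c) (hs : ∀ y ≠ x, s y = s' y) (hx : s x ≠ s' x)
    (h : D.SameCircle s (x, 0) (x, 2)) : ¬ D.SameCircle s' (x, 0) (x, 2) := by
  classical
  have z2 : ∀ u v : ZMod 2, u ≠ v → u = v + 1 := by decide
  have z2' : ∀ u : ZMod 2, u + 1 + 1 = u := by decide
  have z2'' : ∀ u : ZMod 2, u + 1 ≠ u := by decide
  have c2 : c (x, 2) = c (x, 0) := by
    have h0 : c (x, 1) = c (x, 0) + 1 := hc.turn x 0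
    have h1 : c (x, 2) = c (x, 1) + 1 := hc.turn x 1
    rw [h1, h0, z2']
  -- the permutation `edge ∘ splice`, on half-edges of the colour of `(x, 0)`
  let p : (X → Bool) → X × Fin 4 → X × Fin 4 := fun t d => D.edge (d.1, LinkDiagram.splice (t d.1) d.2)
  have pinj : ∀ t, Function.Injective (p t) := by
    rintro t ⟨y, i⟩ ⟨z, j⟩ hyz
    have h1 := congrArg D.edge hyz
    simp only [p, D.edge_edge, Prod.mk.injEq] at h1
    obtain ⟨rfl, h1⟩ := h1
    rw [← splice_splice (t y) i, h1, splice_splice]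
  have pc : ∀ t d, c (p t d) = c d := by
    rintro t ⟨y, i⟩
    simp only [p, hc.edge, hc.splice, z2']
  let P : Equiv.Perm (X × Fin 4) := Equiv.ofBijective (p s) (pinj s).bijective_of_finite
  have hP : P.SameCycle (x, 0) (x, 2) := by
    -- A half-edge of the wrong colour is replaced by the other half of its edge. The resulting map
    -- to cycles of `P` is constant on circles of `s`, so a circle meets the chosen colour in a
    -- single cycle.
    let f : X × Fin 4 → Quotient (Equiv.Perm.SameCycle.setoid P) :=
      fun d => Quotient.mk _ (if c d = c (x, 0) then d else D.edge d)
    have hf : f (x, 0) = f (x, 2) := by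
      refine h.apply_eq (fun d => ?_) (fun y i => ?_)
      · by_cases hd : c d = c (x, 0)
        · simp [f, hd, hc.edge, D.edge_edge]
        · simp [f, hc.edge, z2 _ _ hd, z2']
      · apply Quotient.sound
        by_cases hd : c (y, i) = c (x, 0)
        · simp only [hd, hc.splice, z2'', if_false, if_true]
          exact (Equiv.Perm.sameCycle_apply_left (f := P)).2
            (Equiv.Perm.SameCycle.refl P (y, i))
        · have h1 : D.edge (y, i) = P (y, LinkDiagram.splice (s y) i) := by
            simp [P, p, splice_splice]
          simp only [hc.splice, z2 _ _ hd, z2', if_true]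
          rw [if_neg (z2'' _), h1]
          exact (Equiv.Perm.sameCycle_apply_right (f := P)).2 (.refl _ _)
    have : P.SameCycle (if c (x, 0) = c (x, 0) then (x, 0) else D.edge (x, 0))
      (if c (x, 2) = c (x, 0) then (x, 2) else D.edge (x, 2)) := Quotient.exact hf
    simpa [c2] using this
  have hex : ∃ k, (p s)^[k] (x, 0) = (x, 2) := by
    obtain ⟨k, -, hk⟩ := hP.exists_pow_eq'
    refine ⟨k, ?_⟩
    rw [← hk, Equiv.Perm.coe_pow]
    rfl
  have hj := Nat.find_spec hex
  have hmin := fun i => @Nat.find_min _ _ hex i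
  set j := Nat.find hex
  -- `O` is the arc travelled from just after `(x, 0)` up to the first visit of `(x, 2)`. It will
  -- turn out to be closed under travel in `s'`, which separates `(x, 2)` from `(x, 0)`.
  let O : Finset (X × Fin 4) := (Finset.Icc 1 j).image fun i => (p s)^[i] (x, 0)
  have hO : ∀ d, d ∈ O ↔ ∃ i, (1 ≤ i ∧ i ≤ j) ∧ (p s)^[i] (x, 0) = d := fun d => by simp [O]
  have hj1 : 1 ≤ j := by
    rcases Nat.eq_zero_or_pos j with h0 | h0
    · simp [h0] at hj
    · exact h0
  have h2O : (x, 2) ∈ O := (hO _).2 ⟨j, ⟨hj1, le_rfl⟩, hj⟩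
  have h0O : (x, 0) ∉ O := by
    intro h0
    obtain ⟨i, ⟨hi1, hi2⟩, hi⟩ := (hO _).1 h0
    refine hmin (j - i) (by omega) ?_
    have : (p s)^[(j - i) + i] (x, 0) = (x, 2) := by rw [Nat.sub_add_cancel hi2, hj]
    rwa [Function.iterate_add_apply, hi] at this
  have hOc : ∀ d ∈ O, c d = c (x, 0) := by
    intro d hd
    obtain ⟨i, -, rfl⟩ := (hO _).1 hd
    clear hd
    induction i with
    | zero => rfl
    | succ i ih => rw [Function.iterate_succ_apply', pc, ih]
  have hpO : ∀ d ∈ O, p s' d ∈ O := by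
    intro d hd
    have hcd := hOc d hd
    obtain ⟨i, ⟨hi1, hi2⟩, hi⟩ := (hO _).1 hd
    by_cases hdx : d.1 = x
    · have hd2 : d = (x, 2) := by
        obtain ⟨y, l⟩ := d
        obtain rfl : y = x := hdx
        have e1 : c (y, 1) = c (y, 0) + 1 := hc.turn y 0
        have e3 : c (y, 3) = c (y, 2) + 1 := hc.turn y 2
        fin_cases l
        · exact absurd hd h0O
        · exact absurd (e1.symm.trans hcd) (z2'' _)
        · rfl
        · exact absurd (e3.symm.trans (hcd.trans c2.symm)) (z2'' _)
      -- The new splicing joins 2 to the old partner of 0, so at the end of the arc the journey in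
      -- `s'` jumps back to its beginning.
      have : p s' (x, 2) = p s (x, 0) := by
        cases e1 : s x <;> cases e2 : s' x <;> simp [e1, e2] at hx <;>
          simp [p, e1, e2, LinkDiagram.splice]
      rw [hd2, this]
      exact (hO _).2 ⟨1, ⟨le_rfl, hj1⟩, rfl⟩
    · have : p s' d = p s d := by simp only [p, hs _ hdx]
      rw [this]
      refine (hO _).2 ⟨i + 1, ⟨by omega, ?_⟩, by rw [Function.iterate_succ_apply', hi]⟩
      rcases hi2.eq_or_lt with rfl | hlt
      · exact absurd (congrArg Prod.fst (hi.symm.trans hj)) hdx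
      · exact hlt
  have hpO' : ∀ d, p s' d ∈ O → d ∈ O := by
    intro d hd
    have himg : O.image (p s') = O :=
      Finset.eq_of_subset_of_card_le (Finset.image_subset_iff.2 hpO)
        (Finset.card_image_of_injective _ (pinj s')).ge
    rw [← himg] at hd
    obtain ⟨e, he, hde⟩ := Finset.mem_image.1 hd
    rwa [← pinj s' hde]
  have key : ∀ d e, D.SameCircle s' d e →
      (if c d = c (x, 0) then d ∈ O else D.edge d ∈ O) =
        (if c e = c (x, 0) then e ∈ O else D.edge e ∈ O) := by
    intro d e hde
    refine hde.apply_eq (f := fun d => if c d = c (x, 0) then d ∈ O else D.edge d ∈ O)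
      (fun d => ?_) (fun y i => ?_)
    · by_cases hd : c d = c (x, 0)
      · simp [hd, hc.edge, D.edge_edge]
      · simp [hc.edge, z2 _ _ hd, z2']
    · by_cases hd : c (y, i) = c (x, 0)
      · simp only [hd, hc.splice, z2'', if_false, if_true]
        exact propext ⟨hpO' (y, i), hpO (y, i)⟩
      · have h1 : D.edge (y, i) = p s' (y, LinkDiagram.splice (s' y) i) := by
          simp [p, splice_splice]
        simp only [hc.splice, z2 _ _ hd, z2', if_true]
        rw [if_neg (z2'' _), h1]
        exact propext ⟨hpO _, hpO' _⟩
  intro h'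
  have := key _ _ h'
  simp [c2, h2O, h0O] at this

variable (D) in
/-- The number of circles of a state that pass through crossings. -/
noncomputable abbrev circleCount (s : X → Bool) : ℕ := Nat.card (Quot (D.stateRel s))

/-- Both states have the same quotient after identifying `(x, 0)` with `(x, 2)`. This identification
costs `s` one circle and `s'` none. -/
theorem circleCount_switch_of_not [Finite X] (hs : ∀ y ≠ x, s y = s' y) (hx : s x ≠ s' x)
    (h : ¬ D.SameCircle s (x, 0) (x, 2)) : D.circleCount s = D.circleCount s' + 1 := by
  rw [circleCount, card_quot_of_not_eqvGen h, circleCount,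
    card_quot_of_eqvGen (sameCircle_switch_of_not hs hx h),
    card_quot_eq_of_eqvGen_iff (mergeRel_iff_of_agree hs)]

theorem IsCheckerboard.circleCount_switch [Finite X] {c : X × Fin 4 → ZMod 2}
    (hc : D.IsCheckerboard c) (hs : ∀ y ≠ x, s y = s' y) (hx : s x ≠ s' x)
    (h : D.SameCircle s (x, 0) (x, 2)) : D.circleCount s' = D.circleCount s + 1 :=
  circleCount_switch_of_not (fun y hy => (hs y hy).symm) hx.symm (hc.not_sameCircle_switch hs hx h)

theorem IsCheckerboard.circleCount_switch_le [Finite X] {c : X × Fin 4 → ZMod 2}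
    (hc : D.IsCheckerboard c) (hs : ∀ y ≠ x, s y = s' y) (hx : s x ≠ s' x) :
    D.circleCount s' ≤ D.circleCount s + 1 := by
  by_cases h : D.SameCircle s (x, 0) (x, 2)
  · exact (hc.circleCount_switch hs hx h).le
  · have := circleCount_switch_of_not hs hx h
    omega

end LinkDiagram

/-! ## Homological planarity and the Jordan property of state circles -/

namespace LinkDiagram

open Relation

variable {X : Type*}

/-- Every cycle mod 2 on the edges of the diagram is the boundary of a set of faces: `τ d` tells
whether the face at the corner clockwise of the half-edge `d` belongs to the set. -/
def IsHomPlanar (D : LinkDiagram X) : Prop :=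
  ∀ z : X × Fin 4 → ZMod 2, (∀ d, z (D.edge d) = z d) → (∀ x, ∑ i, z (x, i) = 0) →
    ∃ τ : X × Fin 4 → ZMod 2, (∀ d, τ ((D.edge d).1, (D.edge d).2 + 1) = τ d) ∧
      ∀ x i, τ (x, i + 1) = τ (x, i) + z (x, i)

variable {D : LinkDiagram X} {s s' : X → Bool} {x y : X}

/-- Crossings have even valence, so the sum of all edges is a cycle mod 2. A set of faces bounded by
it changes across every edge. -/
theorem IsHomPlanar.exists_isCheckerboard (h : D.IsHomPlanar) : ∃ c, D.IsCheckerboard c := by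
  obtain ⟨τ, h1, h2⟩ := h (fun _ => 1) (fun _ => rfl) (fun _ => by simp; decide)
  refine ⟨τ, fun d => ?_, h2⟩
  have := h1 (D.edge d)
  rw [D.edge_edge] at this
  rw [← this, h2]

open Classical in
/-- Every circle of a state separates the sphere. -/
theorem IsHomPlanar.exists_side (h : D.IsHomPlanar) {c : X × Fin 4 → ZMod 2}
    (hc : D.IsCheckerboard c) (s : X → Bool) (d₀ : X × Fin 4) :
    ∃ τ : X × Fin 4 → ZMod 2,
      (∀ x i, τ (x, i + 1) = τ (x, i) + if D.SameCircle s (x, i) d₀ then 1 else 0) ∧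
      (∀ d e, D.SameCircle s d e → D.SameCircle s d d₀ → τ d + c d = τ e + c e) ∧
      (∀ d e, D.SameCircle s d e → ¬ D.SameCircle s d d₀ → τ d = τ e) := by
  have hedge : ∀ d, D.SameCircle s (D.edge d) d₀ ↔ D.SameCircle s d d₀ := fun d =>
    ⟨fun h => (sameCircle_edge s d).trans _ _ _ h, fun h => (sameCircle_edge s d).symm.trans _ _ _ h⟩
  have hspl : ∀ x i, D.SameCircle s (x, splice (s x) i) d₀ ↔ D.SameCircle s (x, i) d₀ := fun x i =>
    ⟨fun h => (sameCircle_splice s x i).trans _ _ _ h,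
      fun h => (sameCircle_splice s x i).symm.trans _ _ _ h⟩
  have zz : ∀ u : ZMod 2, u + u = 0 := by decide
  -- The circle of `d₀` is a cycle mod 2, because the splicing pairs its half-edges at each
  -- crossing; `τ` indicates one side of it.
  obtain ⟨τ, h1, h2⟩ := h (fun d => if D.SameCircle s d d₀ then 1 else 0)
    (fun d => by simp only [hedge]) (fun x => by
      have a0 := hspl x 0
      have a2 := hspl x 2
      rw [Fin.sum_univ_four]
      cases hx : s x <;> simp only [hx, splice, Matrix.cons_val] at a0 a2 <;>
        simp only [a0, a2]
      · linear_combination zz (if D.SameCircle s (x, 0) d₀ then 1 else 0) +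
          zz (if D.SameCircle s (x, 2) d₀ then 1 else 0)
      · linear_combination zz (if D.SameCircle s (x, 0) d₀ then 1 else 0) +
          zz (if D.SameCircle s (x, 2) d₀ then 1 else 0))
  -- Along the circle itself the clockwise corners of successive half-edges lie on alternating
  -- sides, just as their colours alternate; adding `c` cancels this. Any other circle stays on one
  -- side.
  let g : X × Fin 4 → ZMod 2 := fun d => τ d + if D.SameCircle s d d₀ then c d else 0
  have hτe : ∀ d, τ (D.edge d) = τ d + if D.SameCircle s d d₀ then 1 else 0 := by
    intro d
    have := h1 (D.edge d)
    rw [D.edge_edge] at this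
    rw [← this, h2]
  have hτs : ∀ x i, τ (x, splice (s x) i) =
      τ (x, i) + if D.SameCircle s (x, i) d₀ then 1 else 0 := by
    intro x i
    have a0 := hspl x 0
    have a2 := hspl x 2
    have b0 : τ (x, 1) = τ (x, 0) + (if D.SameCircle s (x, 0) d₀ then 1 else 0) := h2 x 0
    have b1 : τ (x, 2) = τ (x, 1) + (if D.SameCircle s (x, 1) d₀ then 1 else 0) := h2 x 1
    have b2 : τ (x, 3) = τ (x, 2) + (if D.SameCircle s (x, 2) d₀ then 1 else 0) := h2 x 2
    have b3 : τ (x, 0) = τ (x, 3) + (if D.SameCircle s (x, 3) d₀ then 1 else 0) := h2 x 3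
    cases hx : s x <;> simp only [hx, splice, Matrix.cons_val] at a0 a2
    · simp only [a2] at b1
      simp only [a0] at b3
      fin_cases i <;> simp only [splice, Matrix.cons_val, Fin.zero_eta, Fin.mk_one,
        Fin.reduceFinMk, a0, a2]
      · linear_combination -b3 - zz (if D.SameCircle s (x, 0) d₀ then 1 else 0)
      · exact b1
      · linear_combination -b1 - zz (if D.SameCircle s (x, 2) d₀ then 1 else 0)
      · exact b3
    · fin_cases i <;> simp only [splice, Matrix.cons_val, Fin.zero_eta, Fin.mk_one,
        Fin.reduceFinMk, a0, a2]
      · exact b0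
      · linear_combination -b0 - zz (if D.SameCircle s (x, 0) d₀ then 1 else 0)
      · exact b2
      · linear_combination -b2 - zz (if D.SameCircle s (x, 2) d₀ then 1 else 0)
  have hg : ∀ d e, D.SameCircle s d e → g d = g e := by
    intro d e hde
    refine hde.apply_eq (fun d => ?_) (fun x i => ?_)
    · by_cases hd : D.SameCircle s d d₀
      · simp only [g, hτe, hedge, hd, if_true, hc.edge]
        linear_combination zz 1
      · simp only [g, hτe, hedge, hd, if_false, add_zero]
    · by_cases hd : D.SameCircle s (x, i) d₀
      · simp only [g, hτs, hspl, hd, if_true, hc.splice]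
        linear_combination zz 1
      · simp only [g, hτs, hspl, hd, if_false, add_zero]
  refine ⟨τ, h2, fun d e hde hd => ?_, fun d e hde hd => ?_⟩
  · have he : D.SameCircle s e d₀ := hde.symm.trans _ _ _ hd
    simpa [g, hd, he] using hg d e hde
  · have he : ¬ D.SameCircle s e d₀ := fun h => hd (hde.trans _ _ _ h)
    simpa [g, hd, he] using hg d e hde

/-- Two crossings whose `A`-splicings join the same two circles of a state `s` are on the same
side of these circles. -/
theorem IsHomPlanar.color_eq_of_parallel (h : D.IsHomPlanar) {c : X × Fin 4 → ZMod 2}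
    (hc : D.IsCheckerboard c) (hx : s x = true) (hy : s y = true)
    (hne : ¬ D.SameCircle s (x, 0) (x, 2))
    (hp : (D.SameCircle s (x, 0) (y, 0) ∧ D.SameCircle s (x, 2) (y, 2)) ∨
      (D.SameCircle s (x, 0) (y, 2) ∧ D.SameCircle s (x, 2) (y, 0))) :
    c (x, 0) = c (y, 0) := by
  -- On the circle of `(x, 0)` the sum `τ + c` is constant, and on the other circle `τ` is constant.
  -- As `τ` jumps between the two arcs at a crossing, the colour there is determined by the side on
  -- which the other circle lies, which is the same for `x` and `y`.
  obtain ⟨τ, h1, h2, h3⟩ := h.exists_side hc s (x, 0)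
  have x01 : D.SameCircle s (x, 0) (x, 1) := sameCircle_splice' hx 0
  have y01 : D.SameCircle s (y, 0) (y, 1) := sameCircle_splice' hy 0
  have y23 : D.SameCircle s (y, 2) (y, 3) := sameCircle_splice' hy 2
  have t2 : τ (x, 2) = τ (x, 1) + 1 := by
    have := h1 x 1
    rwa [if_pos x01.symm] at this
  have cx : c (x, 1) = c (x, 0) + 1 := hc.turn x 0
  have cy : c (y, 1) = c (y, 0) + 1 := hc.turn y 0
  have cy2 : c (y, 2) = c (y, 1) + 1 := hc.turn y 1
  have cy3 : c (y, 3) = c (y, 2) + 1 := hc.turn y 2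
  have hne' : ¬ D.SameCircle s (x, 2) (x, 0) := fun h => hne h.symm
  rcases hp with ⟨p0, p2⟩ | ⟨p0, p2⟩
  · have e1 := h3 _ _ p2 hne'
    have e2 : τ (y, 2) = τ (y, 1) + 1 := by
      have := h1 y 1
      rwa [if_pos (y01.symm.trans _ _ _ p0.symm)] at this
    have e3 := h2 _ _ (x01.symm.trans _ _ _ (p0.trans _ _ _ y01)) x01.symm
    linear_combination e3 - cx + cy - e1 + t2 - e2
  · have e1 := h3 _ _ p2 hne'
    have e2 : τ (y, 0) = τ (y, 3) + 1 := by
      have := h1 y 3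
      rwa [if_pos (y23.symm.trans _ _ _ p0.symm)] at this
    have e3 := h2 _ _ (x01.symm.trans _ _ _ (p0.trans _ _ _ y23)) x01.symm
    have tt : (2 : ZMod 2) = 0 := rfl
    linear_combination e3 - cx + cy + cy2 + cy3 - e1 + t2 - e2 + tt

/-- Two crossings on the same side of a circle which they meet with both arcs of their
`A`-splicings are not interlaced. -/
theorem IsHomPlanar.sameCircle_switch (h : D.IsHomPlanar) {c : X × Fin 4 → ZMod 2}
    (hc : D.IsCheckerboard c) (hs : ∀ z ≠ y, s z = s' z) (hx : s' x = true) (hy : s' y = false)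
    (hxx : D.SameCircle s (x, 0) (x, 2)) (hcxy : c (x, 0) = c (y, 0)) :
    D.SameCircle s' (x, 0) (x, 2) := by
  by_contra hne
  have hne' : ¬ D.SameCircle s' (x, 2) (x, 0) := fun h => hne h.symm
  have hsw := (LinkDiagram.sameCircle_switch hs hxx).resolve_left hne
  -- If switching `y` separated the arcs at `x`, then `y` would join the same two circles of `s'` as
  -- `x`. The colours are compared as in `IsHomPlanar.color_eq_of_parallel`, but `y` now has a
  -- B-splicing, a quarter turn away, so the colours come out opposite.
  obtain ⟨τ, h1, h2, h3⟩ := h.exists_side hc s' (x, 0)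
  have x01 : D.SameCircle s' (x, 0) (x, 1) := sameCircle_splice' hx 0
  have y03 : D.SameCircle s' (y, 0) (y, 3) := sameCircle_splice' hy 0
  have y21 : D.SameCircle s' (y, 2) (y, 1) := sameCircle_splice' hy 2
  have t2 : τ (x, 2) = τ (x, 1) + 1 := by
    have := h1 x 1
    rwa [if_pos x01.symm] at this
  have cx : c (x, 1) = c (x, 0) + 1 := hc.turn x 0
  have cy : c (y, 1) = c (y, 0) + 1 := hc.turn y 0
  have cy2 : c (y, 2) = c (y, 1) + 1 := hc.turn y 1
  have cy3 : c (y, 3) = c (y, 2) + 1 := hc.turn y 2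
  have tt : (2 : ZMod 2) = 0 := rfl
  have h10 : (1 : ZMod 2) ≠ 0 := by decide
  rcases hsw with ⟨p0, p2⟩ | ⟨p0, p2⟩
  · have e1 := h3 _ _ (p2.trans _ _ _ y21) hne'
    have n2 : ¬ D.SameCircle s' (y, 2) (x, 0) := fun h => hne' (p2.trans _ _ _ h)
    have n1 : ¬ D.SameCircle s' (y, 1) (x, 0) := fun h => n2 (y21.trans _ _ _ h)
    have f1 : τ (y, 2) = τ (y, 1) + 0 := by
      have := h1 y 1
      rwa [if_neg n1] at this
    have f2 : τ (y, 3) = τ (y, 2) + 0 := by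
      have := h1 y 2
      rwa [if_neg n2] at this
    have e3 := h2 _ _ (x01.symm.trans _ _ _ (p0.trans _ _ _ y03)) x01.symm
    apply h10
    linear_combination e3 - cx + cy + cy2 + cy3 - e1 + t2 + f1 + f2 - hcxy + 2 * tt
  · have n0 : ¬ D.SameCircle s' (y, 0) (x, 0) := fun h => hne' (p2.trans _ _ _ h)
    have n3 : ¬ D.SameCircle s' (y, 3) (x, 0) := fun h => n0 (y03.trans _ _ _ h)
    have e1 := h3 _ _ (p2.trans _ _ _ y03) hne'
    have f0 : τ (y, 0) = τ (y, 3) + 0 := by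
      have := h1 y 3
      rwa [if_neg n3] at this
    have f1 : τ (y, 1) = τ (y, 0) + 0 := by
      have := h1 y 0
      rwa [if_neg n0] at this
    have e3 := h2 _ _ (x01.symm.trans _ _ _ (p0.trans _ _ _ y21)) x01.symm
    apply h10
    linear_combination e3 - cx + cy - e1 + t2 + f0 + f1 - hcxy + tt

end LinkDiagram

/-! ## Euler's formula implies homological planarity -/

section Involution

variable {α : Type*} {g : α → α}

theorem quot_involution_eq_iff (hg : ∀ a, g (g a) = a) {a b : α} :
    Quot.mk (fun d e => e = g d) a = Quot.mk (fun d e => e = g d) b ↔ b = a ∨ b = g a := by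
  constructor
  · intro h
    have h' := Quot.eqvGen_exact h
    clear h
    induction h' with
    | rel x y h => exact Or.inr h
    | refl x => exact Or.inl rfl
    | symm x y h ih =>
      rcases ih with rfl | rfl
      · exact Or.inl rfl
      · exact Or.inr (hg _).symm
    | trans x y z h1 h2 ih1 ih2 =>
      rcases ih1 with rfl | rfl
      · exact ih2
      · rcases ih2 with rfl | rfl
        · exact Or.inr rfl
        · exact Or.inl (hg _)
  · rintro (rfl | rfl)
    · rfl
    · exact Quot.sound rfl

theorem two_mul_card_quot_involution [Finite α] (hg : ∀ a, g (g a) = a) (hne : ∀ a, g a ≠ a) :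
    2 * Nat.card (Quot fun d e => e = g d) = Nat.card α := by
  have hout : ∀ q : Quot (fun d e => e = g d), Quot.mk _ q.out = q := Quot.out_eq
  let f : (Quot fun d e => e = g d) × Bool → α := fun p => if p.2 then p.1.out else g p.1.out
  have hf : ∀ p, Quot.mk _ (f p) = p.1 := by
    rintro ⟨q, b⟩
    refine Eq.trans ?_ (hout q)
    cases b
    · exact ((quot_involution_eq_iff hg).2 (Or.inr rfl)).symm
    · rfl
  have hb : f.Bijective := by
    constructor
    · intro p p' h
      have h1 : p.1 = p'.1 := by rw [← hf p, ← hf p', h]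
      obtain ⟨q, b⟩ := p
      obtain ⟨q', b'⟩ := p'
      obtain rfl : q = q' := h1
      cases b <;> cases b' <;> simp only [f] at h ⊢
      · exact absurd h (hne _)
      · exact absurd h.symm (hne _)
    · intro a
      rcases (quot_involution_eq_iff hg).1 (hout (Quot.mk _ a)) with h | h
      · exact ⟨(Quot.mk _ a, true), h.symm⟩
      · exact ⟨(Quot.mk _ a, false), h.symm⟩
  rw [← Nat.card_congr (Equiv.ofBijective f hb), Nat.card_prod, Nat.card_eq_fintype_card (α := Bool),
    Fintype.card_bool, mul_comm]

end Involution

namespace LinkDiagram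

variable {X : Type*} (D : LinkDiagram X)

/-- The edges of a diagram. -/
abbrev Edge : Type _ := Quot fun d e : X × Fin 4 => e = D.edge d

theorem card_edge [Finite X] : Nat.card D.Edge = 2 * Nat.card X := by
  have := two_mul_card_quot_involution D.edge_edge D.edge_ne
  rw [Nat.card_prod, Nat.card_eq_fintype_card (α := Fin 4), Fintype.card_fin] at this
  change Nat.card (Quot _) = _
  omega

/-- The boundary map mod 2 from faces to edges. -/
def faceBoundary : (D.Face → ZMod 2) →ₗ[ZMod 2] (X × Fin 4 → ZMod 2) where
  toFun σ d := σ (Quot.mk _ d) + σ (Quot.mk _ (d.1, d.2 + 1))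
  map_add' σ σ' := by ext d; simp only [Pi.add_apply]; ring
  map_smul' a σ := by ext d; simp only [Pi.smul_apply, smul_eq_mul, RingHom.id_apply]; ring

/-- The 1-cycles mod 2 of a diagram. -/
def cycles [Fintype X] : Submodule (ZMod 2) (X × Fin 4 → ZMod 2) where
  carrier := {z | (∀ d, z (D.edge d) = z d) ∧ ∀ x, ∑ i, z (x, i) = 0}
  zero_mem' := by simp
  add_mem' := by
    rintro a b ⟨h1, h2⟩ ⟨h3, h4⟩
    exact ⟨fun d => by simp [h1, h3], fun x => by simp [Finset.sum_add_distrib, h2, h4]⟩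
  smul_mem' := by
    rintro a b ⟨h1, h2⟩
    refine ⟨fun d => by simp [h1], fun x => ?_⟩
    simp only [Pi.smul_apply, ← Finset.smul_sum, h2, smul_zero]

variable {D}

theorem face_mk_edge (d : X × Fin 4) :
    (Quot.mk _ (D.edge d) : D.Face) = Quot.mk _ (d.1, d.2 + 1) := by
  apply Quot.sound
  rw [D.edge_edge]

theorem face_mk_edge_turn (d : X × Fin 4) :
    (Quot.mk _ ((D.edge d).1, (D.edge d).2 + 1) : D.Face) = Quot.mk _ d :=
  Eq.symm (Quot.sound (r := fun d e : X × Fin 4 => e = ((D.edge d).1, (D.edge d).2 + 1)) rfl)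

theorem range_faceBoundary_le [Fintype X] : LinearMap.range D.faceBoundary ≤ D.cycles := by
  have zz : ∀ u : ZMod 2, u + u = 0 := by decide
  rintro _ ⟨σ, rfl⟩
  refine ⟨fun d => ?_, fun x => ?_⟩
  · simp only [faceBoundary, LinearMap.coe_mk, AddHom.coe_mk, face_mk_edge_turn, face_mk_edge]
    ring
  · simp only [faceBoundary, LinearMap.coe_mk, AddHom.coe_mk, Fin.sum_univ_four]
    have e : ((3 : Fin 4) + 1) = 0 := rfl
    have e1 : ((2 : Fin 4) + 1) = 3 := rfl
    have e2 : ((1 : Fin 4) + 1) = 2 := rfl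
    have e3 : ((0 : Fin 4) + 1) = 1 := rfl
    rw [e, e1, e2, e3]
    linear_combination zz (σ (Quot.mk _ (x, 0))) + zz (σ (Quot.mk _ (x, 1))) +
      zz (σ (Quot.mk _ (x, 2))) + zz (σ (Quot.mk _ (x, 3)))

/-- A set of faces without boundary looks the same on both sides of every edge, hence at all corners
of a crossing and along edges, so it comes from a function on components. -/
theorem finrank_ker_faceBoundary_le [Finite X] :
    Module.finrank (ZMod 2) (LinearMap.ker D.faceBoundary) ≤ Nat.card D.GraphComponent := by
  have zz : ∀ u v : ZMod 2, u + v = 0 → u = v := by decide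
  have hpi : ∀ d e : X × Fin 4, e = ((D.edge d).1, (D.edge d).2 + 1) →
      (Quot.mk _ d : D.GraphComponent) = Quot.mk _ e := by
    rintro d _ rfl
    exact Quot.eqvGen_sound ((Relation.EqvGen.rel d (D.edge d) (Or.inr rfl)).trans _ _ _
      (.rel _ _ (Or.inl rfl)))
  let q : D.Face → D.GraphComponent := Quot.lift (Quot.mk _) hpi
  have hle : LinearMap.ker D.faceBoundary ≤ LinearMap.range (LinearMap.funLeft (ZMod 2) (ZMod 2) q) := by
    intro σ hσ
    have h1 : ∀ d, σ (Quot.mk _ d) = σ (Quot.mk _ (d.1, d.2 + 1)) := fun d =>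
      zz _ _ (congrFun (LinearMap.mem_ker.1 hσ) d)
    have h2 : ∀ x i, σ (Quot.mk _ (x, i)) = σ (Quot.mk _ (x, 0)) := by
      intro x i
      have a0 := h1 (x, 0)
      have a1 := h1 (x, 1)
      have a2 := h1 (x, 2)
      fin_cases i
      · rfl
      · exact a0.symm
      · exact (a0.trans a1).symm
      · exact (a0.trans (a1.trans a2)).symm
    refine ⟨Quot.lift (fun d => σ (Quot.mk _ d)) ?_, ?_⟩
    · rintro ⟨x, i⟩ ⟨y, j⟩ (h | h)
      · obtain rfl : y = x := h
        rw [h2 y i, h2 y j]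
      · rw [h, face_mk_edge]
        exact h1 _
    · ext ⟨d⟩
      rfl
  refine (Submodule.finrank_mono hle).trans ((LinearMap.finrank_range_le _).trans ?_)
  have := Fintype.ofFinite D.GraphComponent
  rw [Module.finrank_fintype_fun_eq_card, Nat.card_eq_fintype_card]

open Classical in
/-- The incidence matrix mod 2 of a diagram. -/
noncomputable def incidence (D : LinkDiagram X) : Matrix X D.Edge (ZMod 2) :=
  fun x ε => ∑ i, if Quot.mk _ (x, i) = ε then 1 else 0

theorem incidence_mulVec [Fintype X] [Fintype D.Edge] (u : D.Edge → ZMod 2) (x : X) :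
    (D.incidence.mulVec u) x = ∑ i, u (Quot.mk _ (x, i)) := by
  simp only [Matrix.mulVec, dotProduct, incidence, Finset.sum_mul]
  rw [Finset.sum_comm]
  refine Finset.sum_congr rfl fun i _ => ?_
  rw [Finset.sum_eq_single (Quot.mk _ (x, i))]
  · simp
  · intro ε _ h
    rw [if_neg h.symm, zero_mul]
  · simp

theorem transpose_incidence_mulVec [Fintype X] [Fintype D.Edge] (g : X → ZMod 2) (d : X × Fin 4) :
    (D.incidence.transpose.mulVec g) (Quot.mk _ d) = g d.1 + g (D.edge d).1 := by
  classical
  simp only [Matrix.mulVec, dotProduct, incidence, Finset.sum_mul, Matrix.transpose_apply]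
  rw [← Fintype.sum_prod_type' (f := fun x i =>
    (if (Quot.mk _ (x, i) : D.Edge) = Quot.mk _ d then (1 : ZMod 2) else 0) * g x)]
  have h : ∀ e : X × Fin 4, ((Quot.mk _ (e.1, e.2) : D.Edge) = Quot.mk _ d) ↔
      e ∈ ({d, D.edge d} : Finset (X × Fin 4)) := by
    intro e
    rw [eq_comm, quot_involution_eq_iff D.edge_edge]
    simp
  simp only [h, ite_mul, one_mul, zero_mul]
  rw [Finset.sum_ite_mem, Finset.univ_inter, Finset.sum_pair (D.edge_ne d).symm]

/-- A function on crossings killed by the transpose is constant along edges, hence comes from a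
function on components. -/
theorem le_rank_incidence [Fintype X] [Fintype D.Edge] :
    Nat.card X ≤ D.incidence.rank + Nat.card D.GraphComponent := by
  have zz : ∀ u v : ZMod 2, u + v = 0 → v = u := by decide
  rw [← Matrix.rank_transpose]
  have h := LinearMap.finrank_range_add_finrank_ker D.incidence.transpose.mulVecLin
  rw [Module.finrank_fintype_fun_eq_card, ← Nat.card_eq_fintype_card] at h
  have hle : LinearMap.ker D.incidence.transpose.mulVecLin ≤
      LinearMap.range (LinearMap.funLeft (ZMod 2) (ZMod 2)
        fun x : X => (Quot.mk _ (x, 0) : D.GraphComponent)) := by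
    intro g hg
    have h1 : ∀ d, g (D.edge d).1 = g d.1 := fun d => by
      apply zz
      rw [← transpose_incidence_mulVec]
      exact congrFun (LinearMap.mem_ker.1 hg) _
    refine ⟨Quot.lift (fun d => g d.1) ?_, ?_⟩
    · rintro d e (h | h)
      · rw [h]
      · rw [h, h1]
    · ext x
      rfl
  have h2 : Module.finrank (ZMod 2) (LinearMap.ker D.incidence.transpose.mulVecLin) ≤
      Module.finrank (ZMod 2) (D.GraphComponent → ZMod 2) :=
    (Submodule.finrank_mono hle).trans (LinearMap.finrank_range_le _)
  have := Fintype.ofFinite D.GraphComponent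
  rw [Module.finrank_fintype_fun_eq_card, ← Nat.card_eq_fintype_card] at h2
  rw [Matrix.rank]
  omega

theorem finrank_cycles_le [Fintype X] :
    Module.finrank (ZMod 2) D.cycles ≤ Nat.card X + Nat.card D.GraphComponent := by
  have := Fintype.ofFinite D.Edge
  have h := LinearMap.finrank_range_add_finrank_ker D.incidence.mulVecLin
  rw [Module.finrank_fintype_fun_eq_card, ← Nat.card_eq_fintype_card, card_edge] at h
  have h1 := D.le_rank_incidence
  rw [Matrix.rank] at h1
  have hle : D.cycles ≤ (LinearMap.ker D.incidence.mulVecLin).map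
      (LinearMap.funLeft (ZMod 2) (ZMod 2) (Quot.mk _ : X × Fin 4 → D.Edge)) := by
    rintro z ⟨hz1, hz2⟩
    refine ⟨Quot.lift z fun d e h => by rw [h, hz1], ?_, ?_⟩
    · refine LinearMap.mem_ker.2 (funext fun x => ?_)
      rw [Matrix.mulVecLin_apply, incidence_mulVec]
      exact hz2 x
    · ext d
      rfl
  have h2 : Module.finrank (ZMod 2) D.cycles ≤
      Module.finrank (ZMod 2) (LinearMap.ker D.incidence.mulVecLin) :=
    (Submodule.finrank_mono hle).trans (Submodule.finrank_map_le _ _)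
  omega

/-- Euler's formula implies that every cycle mod 2 is a boundary. -/
theorem isHomPlanar_of_card_le [Finite X]
    (h : Nat.card X + 2 * Nat.card D.GraphComponent ≤ Nat.card D.Face) : D.IsHomPlanar := by
  have := Fintype.ofFinite X
  have := Fintype.ofFinite D.Face
  have h1 := LinearMap.finrank_range_add_finrank_ker D.faceBoundary
  rw [Module.finrank_fintype_fun_eq_card, ← Nat.card_eq_fintype_card] at h1
  have h2 := D.finrank_ker_faceBoundary_le
  have h3 := D.finrank_cycles_le
  -- With V crossings, F faces and C components, the boundaries have dimension at least F - C ≥ V +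
  -- C, and the cycles at most 2V - (V - C) = V + C.
  have heq := Submodule.eq_of_le_of_finrank_le D.range_faceBoundary_le (by omega)
  intro z hz1 hz2
  have hz : z ∈ D.cycles := ⟨hz1, fun x => by convert hz2 x⟩
  rw [← heq] at hz
  obtain ⟨σ, rfl⟩ := hz
  have zz : ∀ u v : ZMod 2, u = v + (v + u) := by decide
  exact ⟨fun d => σ (Quot.mk _ d), fun d => congrArg σ (face_mk_edge_turn d), fun x i => zz _ _⟩

theorem IsPlanar.isHomPlanar [Finite X] (h : D.IsPlanar) : D.IsHomPlanar :=
  isHomPlanar_of_card_le (Eq.symm h).le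

end LinkDiagram

/-! ## Numbers of circles of the states of an `A`-adequate diagram -/

namespace LinkDiagram

open Relation

variable {X : Type*} {D : LinkDiagram X}

theorem IsAAdequate.not_sameCircle (h : D.IsAAdequate) (x : X) :
    ¬ D.SameCircle (fun _ => true) (x, 0) (x, 2) := by
  intro hx
  refine h.not_isLoopAt x (D.circleAt (fun _ => true) (x, 0)) ?_
  change s(_, _) = s(_, _)
  rw [circleAt_eq_iff.2 hx]

theorem isAAdequate_of_not_sameCircle (h : ∀ x, ¬ D.SameCircle (fun _ => true) (x, 0) (x, 2)) :
    D.IsAAdequate := by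
  refine ⟨fun x u hu => h x ?_⟩
  have hu' : s(u, u) = s(_, _) := hu
  rw [Sym2.eq_iff] at hu'
  rcases hu' with ⟨h1, h2⟩ | ⟨h1, h2⟩
  · exact circleAt_eq_iff.1 (h1.symm.trans h2)
  · exact circleAt_eq_iff.1 (h2.symm.trans h1)

variable (D) in
/-- The two circles of the all-`A` state that meet at a crossing. -/
def aEdge (x : X) : Sym2 (D.Circle fun _ => true) :=
  s(D.circleAt (fun _ => true) (x, 0), D.circleAt (fun _ => true) (x, 2))

theorem aEdge_eq_iff {x y : X} : D.aEdge x = D.aEdge y ↔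
    (D.SameCircle (fun _ => true) (x, 0) (y, 0) ∧ D.SameCircle (fun _ => true) (x, 2) (y, 2)) ∨
      (D.SameCircle (fun _ => true) (x, 0) (y, 2) ∧
        D.SameCircle (fun _ => true) (x, 2) (y, 0)) := by
  simp only [aEdge, Sym2.eq_iff, circleAt_eq_iff]

variable [DecidableEq X]

/-- The state with `B`-splicings exactly at the crossings in `S`. -/
def stateOf (S : Finset X) : X → Bool := fun x => decide (x ∉ S)

theorem stateOf_empty : stateOf (∅ : Finset X) = fun _ => true := by
  ext x; simp [stateOf]

theorem stateOf_of_mem {S : Finset X} {x : X} (h : x ∈ S) : stateOf S x = false := by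
  simp [stateOf, h]

theorem stateOf_of_notMem {S : Finset X} {x : X} (h : x ∉ S) : stateOf S x = true := by
  simp [stateOf, h]

theorem stateOf_insert_agree {S : Finset X} (x : X) :
    ∀ y ≠ x, stateOf S y = stateOf (insert x S) y := by
  intro y hy; simp [stateOf, hy]

theorem stateOf_insert_ne {S : Finset X} {x : X} (h : x ∉ S) :
    stateOf S x ≠ stateOf (insert x S) x := by
  simp [stateOf, h]

variable [Finite X] {c : X × Fin 4 → ZMod 2}

/-- One switch adds at most one circle. Consequently the leading degree of a state term does not
rise when more crossings get a B-splicing. -/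
theorem IsCheckerboard.circleCount_le_of_subset (hc : D.IsCheckerboard c) {S T : Finset X}
    (h : S ⊆ T) : D.circleCount (stateOf T) + S.card ≤ D.circleCount (stateOf S) + T.card := by
  obtain ⟨U, rfl⟩ : ∃ U, T = U ∪ S := ⟨T \ S, by rw [Finset.sdiff_union_of_subset h]⟩
  clear h
  induction U using Finset.induction_on with
  | empty => simp
  | insert x U _ ih =>
    rw [Finset.insert_union]
    by_cases hx : x ∈ U ∪ S
    · rwa [Finset.insert_eq_of_mem hx]
    · have h2 := hc.circleCount_switch_le (stateOf_insert_agree x) (stateOf_insert_ne hx)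
      rw [Finset.card_insert_of_notMem hx]
      omega

/-- Switching a nonempty set of parallel edges of the `A`-graph. -/
theorem IsHomPlanar.circleCount_of_parallel (h : D.IsHomPlanar) (ha : D.IsAAdequate)
    {S : Finset X} (hS : S.Nonempty) {ε : Sym2 (D.Circle fun _ => true)}
    (hε : ∀ x ∈ S, D.aEdge x = ε) :
    D.circleCount (stateOf S) + 2 = D.circleCount (fun _ => true) + S.card := by
  obtain ⟨c, hc⟩ := h.exists_isCheckerboard
  have hcol : ∀ x y, D.aEdge x = ε → D.aEdge y = ε → c (x, 0) = c (y, 0) := fun x y hx hy =>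
    h.color_eq_of_parallel hc rfl rfl (ha.not_sameCircle x) (aEdge_eq_iff.1 (hx.trans hy.symm))
  -- The induction must also carry that each remaining parallel crossing has both arcs on one
  -- circle, so that its switch splits. Non-interlacing preserves this.
  suffices H : D.circleCount (stateOf S) + 2 = D.circleCount (fun _ => true) + S.card ∧
      ∀ y ∉ S, D.aEdge y = ε → D.SameCircle (stateOf S) (y, 0) (y, 2) from H.1
  induction hS using Finset.Nonempty.cons_induction with
  | singleton x =>
    have hag : ∀ y ≠ x, (fun _ => true) y = stateOf {x} y := fun y hy => by simp [stateOf, hy]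
    have hne : (fun _ => true) x ≠ stateOf {x} x := by simp [stateOf]
    have h1 := circleCount_switch_of_not hag hne (ha.not_sameCircle x)
    have h2 := sameCircle_switch_of_not hag hne (ha.not_sameCircle x)
    refine ⟨by rw [Finset.card_singleton]; omega, fun y _ hy => ?_⟩
    have hx := hε x (Finset.mem_singleton_self x)
    rcases aEdge_eq_iff.1 (hy.trans hx.symm) with ⟨p0, p2⟩ | ⟨p0, p2⟩
    · exact (sameCircle_of_switch hag h2 p0).trans _ _ _
        (h2.trans _ _ _ (sameCircle_of_switch hag h2 p2).symm)
    · exact (sameCircle_of_switch hag h2 p0).trans _ _ _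
        (h2.symm.trans _ _ _ (sameCircle_of_switch hag h2 p2).symm)
  | cons x S hx hS ih =>
    rw [Finset.cons_eq_insert] at hε ⊢
    obtain ⟨ih1, ih2⟩ := ih fun y hy => hε y (Finset.mem_insert_of_mem hy)
    have hxε := hε x (Finset.mem_insert_self _ _)
    have h1 := hc.circleCount_switch (stateOf_insert_agree x) (stateOf_insert_ne hx) (ih2 x hx hxε)
    refine ⟨by rw [Finset.card_insert_of_notMem hx]; omega, fun y hy hyε => ?_⟩
    have hyS : y ∉ S := fun h => hy (Finset.mem_insert_of_mem h)
    exact h.sameCircle_switch hc (stateOf_insert_agree x) (stateOf_of_notMem hy)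
      (stateOf_of_mem (Finset.mem_insert_self _ _)) (ih2 y hyS hyε) (hcol y x hyε hxε)

/-- Switching a set of edges of the `A`-graph that are not all parallel. -/
theorem IsCheckerboard.circleCount_of_not_parallel (hc : D.IsCheckerboard c) (ha : D.IsAAdequate)
    {S : Finset X} {x y : X} (hx : x ∈ S) (hy : y ∈ S) (hxy : D.aEdge x ≠ D.aEdge y) :
    D.circleCount (stateOf S) + 4 ≤ D.circleCount (fun _ => true) + S.card := by
  have hne : y ≠ x := fun h => hxy (by rw [h])
  have hag : ∀ y ≠ x, (fun _ => true) y = stateOf {x} y := fun y hy => by simp [stateOf, hy]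
  have hne' : (fun _ => true) x ≠ stateOf {x} x := by simp [stateOf]
  have h1 := circleCount_switch_of_not hag hne' (ha.not_sameCircle x)
  -- Merging the two circles at `x` can bring the arcs at `y` together only if `y` joins the same
  -- two circles. So switching `y` merges a second time, and later switches cannot make up for it.
  have hy' : ¬ D.SameCircle (stateOf {x}) (y, 0) (y, 2) := by
    intro h
    rcases LinkDiagram.sameCircle_switch (fun z hz => (hag z hz).symm) h with h | ⟨h1, h2⟩ | ⟨h1, h2⟩
    · exact ha.not_sameCircle y h
    · exact hxy (aEdge_eq_iff.2 (Or.inl ⟨h1.symm, h2.symm⟩))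
    · exact hxy (aEdge_eq_iff.2 (Or.inr ⟨h2.symm, h1.symm⟩))
  have h2 := circleCount_switch_of_not (stateOf_insert_agree (S := {x}) y)
    (stateOf_insert_ne (by simpa using hne)) hy'
  have h3 := hc.circleCount_le_of_subset (S := {y, x}) (T := S) (by
    intro z hz
    rcases Finset.mem_insert.1 hz with rfl | hz
    · exact hy
    · rwa [Finset.mem_singleton.1 hz])
  rw [Finset.card_pair hne] at h3
  omega

end LinkDiagram

/-! ## Leading terms of rational functions -/

namespace RatFunc

theorem intDegree_X_zpow (k : ℤ) : (X ^ k : RatFunc ℚ).intDegree = k := by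
  have hX : (X : RatFunc ℚ) ≠ 0 := RatFunc.X_ne_zero
  induction k using Int.induction_on with
  | zero => simp
  | succ i ih => rw [zpow_add_one₀ hX, intDegree_mul (zpow_ne_zero _ hX) hX, ih, intDegree_X]
  | pred i ih =>
    rw [zpow_sub_one₀ hX, intDegree_mul (zpow_ne_zero _ hX) (inv_ne_zero hX), ih, intDegree_inv,
      intDegree_X]
    ring

/-- The rational functions of degree less than `k`. -/
noncomputable def degLT (k : ℤ) : AddSubgroup (RatFunc ℚ) where
  carrier := {f | f ≠ 0 → f.intDegree < k}
  zero_mem' h := absurd rfl h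
  add_mem' := by
    intro f g hf hg h
    by_cases h1 : f = 0
    · rw [h1, zero_add] at h ⊢
      exact hg h
    by_cases h2 : g = 0
    · rw [h2, add_zero] at h ⊢
      exact hf h
    exact (intDegree_add_le h2 h).trans_lt (max_lt (hf h1) (hg h2))
  neg_mem' := by
    intro f hf h
    rw [intDegree_neg]
    exact hf (neg_ne_zero.1 h)

theorem mem_degLT {k : ℤ} {f : RatFunc ℚ} : f ∈ degLT k ↔ (f ≠ 0 → f.intDegree < k) := Iff.rfl

theorem degLT_mono {j k : ℤ} (h : j ≤ k) : degLT j ≤ degLT k := fun _ hf h0 => (hf h0).trans_le h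

/-- Degrees are integers: the factors have degree at most j - 1 and k - 1, so a bound on j + k that
is weaker by one suffices. -/
theorem mul_mem_degLT {j k l : ℤ} {f g : RatFunc ℚ} (hf : f ∈ degLT j) (hg : g ∈ degLT k)
    (h : j + k ≤ l + 1) : f * g ∈ degLT l := by
  intro h0
  have h1 := left_ne_zero_of_mul h0
  have h2 := right_ne_zero_of_mul h0
  have := hf h1
  have := hg h2
  rw [intDegree_mul h1 h2]
  omega

theorem X_zpow_mem_degLT {j k : ℤ} (h : j < k) : (X ^ j : RatFunc ℚ) ∈ degLT k := fun _ => by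
  rwa [intDegree_X_zpow]

theorem intCast_mem_degLT {k : ℤ} (a : ℤ) (h : 0 < k) : (a : RatFunc ℚ) ∈ degLT k := fun _ => by
  have : (a : RatFunc ℚ) = C (a : ℚ) := by simp
  rwa [this, intDegree_C]

/-- `f = a X ^ k + b X ^ (k - 4) + (terms of degree less than k - 4)`. -/
def Expands (f : RatFunc ℚ) (k a b : ℤ) : Prop :=
  f - ((a : RatFunc ℚ) * X ^ k + (b : RatFunc ℚ) * X ^ (k - 4)) ∈ degLT (k - 4)

variable {f g : RatFunc ℚ} {k k' a b a' b' : ℤ}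

theorem intCast_mul_X_zpow_mem_degLT {j : ℤ} (h : j < k) :
    (a : RatFunc ℚ) * X ^ j ∈ degLT k :=
  mul_mem_degLT (intCast_mem_degLT a one_pos) (X_zpow_mem_degLT h) (by omega)

theorem Expands.mem_degLT (h : Expands f k a b) : f ∈ degLT (k + 1) := by
  have h1 := (degLT (k + 1)).add_mem (degLT_mono (by omega) h)
    ((degLT (k + 1)).add_mem (intCast_mul_X_zpow_mem_degLT (a := a) (j := k) (by omega))
      (intCast_mul_X_zpow_mem_degLT (a := b) (j := k - 4) (by omega)))
  rwa [sub_add_cancel] at h1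

theorem expands_of_mem_degLT (h : f ∈ degLT (k - 4)) : Expands f k 0 0 := by
  simpa [Expands] using h

/-- This brings state terms that start four degrees below the top to the common exponent. -/
theorem Expands.shift (h : Expands f (k - 4) a b) : Expands f k 0 a := by
  have h1 := (degLT (k - 4)).add_mem (degLT_mono (by omega) h)
    (intCast_mul_X_zpow_mem_degLT (a := b) (j := k - 4 - 4) (by omega))
  unfold Expands
  convert h1 using 1
  push_cast
  ring

theorem Expands.add (h : Expands f k a b) (h' : Expands g k a' b') :
    Expands (f + g) k (a + a') (b + b') := by
  unfold Expands
  convert (degLT (k - 4)).add_mem h h' using 1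
  push_cast
  ring

theorem expands_zero : Expands 0 k 0 0 := expands_of_mem_degLT (degLT (k - 4)).zero_mem

theorem expands_sum {ι : Type*} (s : Finset ι) {f : ι → RatFunc ℚ} {a b : ι → ℤ}
    (h : ∀ i ∈ s, Expands (f i) k (a i) (b i)) :
    Expands (∑ i ∈ s, f i) k (∑ i ∈ s, a i) (∑ i ∈ s, b i) := by
  classical
  induction s using Finset.induction_on with
  | empty => simpa using expands_zero
  | insert i s hi ih =>
    rw [Finset.sum_insert hi, Finset.sum_insert hi, Finset.sum_insert hi]
    exact (h i (Finset.mem_insert_self _ _)).add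
      (ih fun j hj => h j (Finset.mem_insert_of_mem hj))

theorem Expands.mul (h : Expands f k a b) (h' : Expands g k' a' b') :
    Expands (f * g) (k + k') (a * a') (a * b' + b * a') := by
  have hX : (X : RatFunc ℚ) ≠ 0 := RatFunc.X_ne_zero
  have h1 := mul_mem_degLT h h'.mem_degLT (l := k + k' - 4) (by omega)
  have h2 := mul_mem_degLT ((degLT (k + 1)).add_mem
    (intCast_mul_X_zpow_mem_degLT (a := a) (j := k) (by omega))
    (intCast_mul_X_zpow_mem_degLT (a := b) (j := k - 4) (by omega))) h' (l := k + k' - 4) (by omega)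
  have h3 : ((b * b' : ℤ) : RatFunc ℚ) * X ^ (k + k' - 8) ∈ degLT (k + k' - 4) :=
    intCast_mul_X_zpow_mem_degLT (by omega)
  unfold Expands
  convert (degLT _).add_mem h1 ((degLT _).add_mem h2 h3) using 1
  have e1 : (X : RatFunc ℚ) ^ (k + k') = X ^ k * X ^ k' := zpow_add₀ hX _ _
  have e2 : (X : RatFunc ℚ) ^ (k + k' - 4) = X ^ k * X ^ (k' - 4) := by
    rw [← zpow_add₀ hX, add_sub_assoc]
  have e3 : (X : RatFunc ℚ) ^ (k + k' - 8) = X ^ (k - 4) * X ^ (k' - 4) := by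
    rw [← zpow_add₀ hX]; congr 1; ring
  have e4 : (X : RatFunc ℚ) ^ (k - 4) * X ^ k' = X ^ k * X ^ (k' - 4) := by
    rw [← zpow_add₀ hX, ← zpow_add₀ hX]; congr 1; ring
  rw [e1, e2, e3]
  push_cast
  linear_combination (b * a' : RatFunc ℚ) * e4

theorem expands_X_zpow (k : ℤ) : Expands (X ^ k) k 1 0 := by
  simp [Expands, (degLT (k - 4)).zero_mem]

theorem expands_intCast (a : ℤ) : Expands (a : RatFunc ℚ) 0 a 0 := by
  simp [Expands]

theorem expands_loopValue : Expands (-X ^ (2 : ℤ) - X ^ (-2 : ℤ)) 2 (-1) (-1) := by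
  have : (-X ^ (2 : ℤ) - X ^ (-2 : ℤ) : RatFunc ℚ) -
      (((-1 : ℤ) : RatFunc ℚ) * X ^ (2 : ℤ) + ((-1 : ℤ) : RatFunc ℚ) * X ^ ((2 : ℤ) - 4)) = 0 := by
    norm_num
    ring
  rw [Expands, this]
  exact (degLT _).zero_mem

theorem expands_loopValue_pow (n : ℕ) :
    Expands ((-X ^ (2 : ℤ) - X ^ (-2 : ℤ)) ^ n) (2 * n) ((-1) ^ n) ((-1) ^ n * n) := by
  induction n with
  | zero => simpa using expands_intCast 1
  | succ n ih =>
    rw [pow_succ]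
    convert ih.mul expands_loopValue using 1
    · push_cast; ring
    · ring
    · push_cast; ring

end RatFunc

/-! ## Leading terms of the Kauffman bracket of an `A`-adequate diagram -/

/-- Alternating count of the nonempty sets on which a function is constant. -/
theorem sum_neg_one_pow_card_constant {X E : Type*} [Fintype X] [DecidableEq X] [DecidableEq E]
    (f : X → E) [DecidablePred fun S : Finset X => S.Nonempty ∧ ∃ ε, ∀ x ∈ S, f x = ε] :
    ∑ S : Finset X with S.Nonempty ∧ ∃ ε, ∀ x ∈ S, f x = ε, (-1 : ℤ) ^ S.card =
      -((Finset.univ.image f).card : ℤ) := by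
  have h : (Finset.univ.filter fun S : Finset X => S.Nonempty ∧ ∃ ε, ∀ x ∈ S, f x = ε) =
      (Finset.univ.image f).biUnion fun ε =>
        ((Finset.univ.filter fun x => f x = ε).powerset).erase ∅ := by
    ext S
    simp only [Finset.mem_filter, Finset.mem_univ, true_and, Finset.mem_biUnion, Finset.mem_image,
      Finset.mem_erase, Finset.mem_powerset, Finset.nonempty_iff_ne_empty]
    constructor
    · rintro ⟨h1, ε, h2⟩
      obtain ⟨x, hx⟩ := Finset.nonempty_iff_ne_empty.2 h1
      exact ⟨ε, ⟨x, h2 x hx⟩, h1, fun y hy => by simp [h2 y hy]⟩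
    · rintro ⟨ε, -, h1, h2⟩
      exact ⟨h1, ε, fun x hx => by simpa using h2 hx⟩
  rw [h, Finset.sum_biUnion]
  · rw [Finset.sum_congr rfl (g := fun _ => (-1 : ℤ))]
    · simp
    · intro ε hε
      obtain ⟨x, -, hx⟩ := Finset.mem_image.1 hε
      have hne : (Finset.univ.filter fun x => f x = ε).Nonempty := ⟨x, by simp [hx]⟩
      -- The signs over all subsets of a nonempty fibre cancel, so leaving out the empty set leaves
      -- -1 for each fibre.
      have := Finset.sum_powerset_neg_one_pow_card_of_nonempty hne
      rw [← Finset.sum_erase_add _ _ (Finset.empty_mem_powerset _)] at this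
      simp only [Finset.card_empty, pow_zero] at this
      linarith
  · intro ε _ ε' _ hne
    refine Finset.disjoint_left.2 fun S hS hS' => hne ?_
    obtain ⟨h1, h2⟩ := Finset.mem_erase.1 hS
    obtain ⟨h3, h4⟩ := Finset.mem_erase.1 hS'
    obtain ⟨x, hx⟩ := Finset.nonempty_iff_ne_empty.2 h1
    have e1 := Finset.mem_powerset.1 h2 hx
    have e2 := Finset.mem_powerset.1 h4 hx
    simp only [Finset.mem_filter, Finset.mem_univ, true_and] at e1 e2
    rw [← e1, ← e2]

namespace LinkDiagram

open RatFunc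

variable {X : Type*} {D : LinkDiagram X} {c : X × Fin 4 → ZMod 2}

theorem circleCount_pos [Finite X] [Nonempty X] (s : X → Bool) : 0 < D.circleCount s :=
  Nat.card_pos_iff.2 ⟨⟨Quot.mk _ (Classical.arbitrary X, 0)⟩, inferInstance⟩

variable [DecidableEq X]

theorem expands_stateTerm (S : Finset X) {d : ℕ}
    (hd : D.circleCount (stateOf S) + D.loops = d + 1) :
    Expands (RatFunc.X ^ ((Nat.card X : ℤ) - 2 * S.card) *
      (-RatFunc.X ^ (2 : ℤ) - RatFunc.X ^ (-2 : ℤ)) ^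
        (((D.circleCount (stateOf S) + D.loops : ℕ) : ℤ) - 1))
      ((Nat.card X : ℤ) - 2 * S.card + 2 * d) ((-1) ^ d) ((-1) ^ d * d) := by
  rw [hd]
  have h := (expands_X_zpow ((Nat.card X : ℤ) - 2 * S.card)).mul (expands_loopValue_pow d)
  convert h using 1
  · push_cast
    rw [add_sub_cancel_right, zpow_natCast]
  · ring
  · ring

variable [Fintype X]

/-- The equivalence between sets of crossings and states. -/
def stateEquiv : Finset X ≃ (X → Bool) where
  toFun := stateOf
  invFun s := Finset.univ.filter fun x => s x = false
  left_inv S := by ext x; simp [stateOf]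
  right_inv s := by ext x; simp [stateOf]

theorem bracket_eq_sum : D.bracket = ∑ S : Finset X,
    RatFunc.X ^ ((Nat.card X : ℤ) - 2 * S.card) *
      (-RatFunc.X ^ (2 : ℤ) - RatFunc.X ^ (-2 : ℤ)) ^
        (((D.circleCount (stateOf S) + D.loops : ℕ) : ℤ) - 1) := by
  rw [bracket, ← Equiv.sum_comp stateEquiv]
  refine Finset.sum_congr rfl fun S _ => ?_
  have h1 : Nat.card {x // stateOf S x = false} = S.card := by
    rw [Nat.card_eq_fintype_card, Fintype.card_subtype]
    congr 1
    ext x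
    simp [stateOf]
  have h2 : Nat.card {x // stateOf S x = true} + S.card = Nat.card X := by
    rw [Nat.card_eq_fintype_card, Fintype.card_subtype, Nat.card_eq_fintype_card,
      ← Finset.card_univ, ← Finset.card_filter_add_card_filter_not (s := Finset.univ)
        (fun x => stateOf S x = true)]
    congr 2
    ext x
    simp [stateOf]
  have h3 : (stateEquiv S : X → Bool) = stateOf S := rfl
  rw [h3, card_circle, h1, ← h2]
  congr 2
  push_cast
  ring

variable (D) in
/-- The number of circles of the all-`A` state. -/
noncomputable def aCircleCount : ℕ := D.circleCount (fun _ => true) + D.loops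

/-- The degree of the bracket is bounded by the degree of the all-`A` state. -/
theorem IsCheckerboard.bracket_mem_degLT (hc : D.IsCheckerboard c) [Nonempty X] :
    D.bracket ∈ degLT ((Nat.card X : ℤ) + 2 * D.aCircleCount - 1) := by
  rw [bracket_eq_sum]
  refine (degLT _).sum_mem fun S _ => ?_
  have h0 := circleCount_pos (D := D) (stateOf S)
  obtain ⟨d, hd⟩ : ∃ d, D.circleCount (stateOf S) + D.loops = d + 1 :=
    ⟨D.circleCount (stateOf S) + D.loops - 1, by omega⟩
  have h1 := hc.circleCount_le_of_subset (Finset.empty_subset S)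
  rw [stateOf_empty, Finset.card_empty] at h1
  refine degLT_mono ?_ (expands_stateTerm S hd).mem_degLT
  rw [aCircleCount]
  push_cast
  omega

open Classical in
/-- The first two coefficients of the bracket of an `A`-adequate diagram. -/
theorem IsHomPlanar.expands_bracket (h : D.IsHomPlanar) (ha : D.IsAAdequate) [Nonempty X] :
    ∃ ε : ℤ, |ε| = 1 ∧ Expands D.bracket ((Nat.card X : ℤ) + 2 * D.aCircleCount - 2) ε
      (ε * ((D.aCircleCount : ℤ) - 1 - (Finset.univ.image D.aEdge).card)) := by
  obtain ⟨c, hc⟩ := h.exists_isCheckerboard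
  set k : ℤ := (Nat.card X : ℤ) + 2 * D.aCircleCount - 2 with hk
  obtain ⟨v, hv⟩ : ∃ v, D.aCircleCount = v + 1 := ⟨D.aCircleCount - 1, by
    have := circleCount_pos (D := D) (fun _ => true)
    rw [aCircleCount]
    omega⟩
  refine ⟨(-1) ^ v, by simp, ?_⟩
  rw [bracket_eq_sum]
  have key := expands_sum (k := k) (Finset.univ : Finset (Finset X))
    (f := fun S => RatFunc.X ^ ((Nat.card X : ℤ) - 2 * S.card) *
      (-RatFunc.X ^ (2 : ℤ) - RatFunc.X ^ (-2 : ℤ)) ^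
        (((D.circleCount (stateOf S) + D.loops : ℕ) : ℤ) - 1))
    -- Only the all-A state reaches degree `k`, and it contributes v from δ^v at degree k - 4. The
    -- other contributions there come from nonempty parallel sets. Here `v` is the number of
    -- A-circles minus one.
    (a := fun S => if S = ∅ then (-1 : ℤ) ^ v else 0)
    (b := fun S => (if S = ∅ then (-1) ^ v * (v : ℤ) else 0) + (-1) ^ v *
      if S.Nonempty ∧ ∃ ε, ∀ x ∈ S, D.aEdge x = ε then (-1) ^ S.card else 0)
    (fun S _ => by
      have h0 := circleCount_pos (D := D) (stateOf S)
      obtain ⟨d, hd⟩ : ∃ d, D.circleCount (stateOf S) + D.loops = d + 1 :=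
        ⟨D.circleCount (stateOf S) + D.loops - 1, by omega⟩
      have ht := expands_stateTerm S hd
      rcases S.eq_empty_or_nonempty with rfl | hS
      · have : d = v := by
          rw [stateOf_empty] at hd
          rw [aCircleCount] at hv
          omega
        subst this
        simp only [if_true, Finset.not_nonempty_empty, false_and, if_false, mul_zero, add_zero]
        convert ht using 1
        rw [hk, hv, Finset.card_empty]
        push_cast
        ring
      · by_cases hp : ∃ ε, ∀ x ∈ S, D.aEdge x = ε
        · obtain ⟨ε, hε⟩ := hp
          -- The first switch merges and the other |S| - 1 split, so the exponent of δ is v + |S| -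
          -- 2 and the term starts exactly at degree k - 4.
          have h1 := h.circleCount_of_parallel ha hS hε
          have h2 : d + 2 = v + S.card := by
            rw [aCircleCount] at hv
            omega
          have hkd : (Nat.card X : ℤ) - 2 * S.card + 2 * d = k - 4 := by
            rw [hk, hv]
            push_cast
            omega
          rw [hkd] at ht
          convert ht.shift using 1
          · simp [hS.ne_empty]
          · rw [if_neg hS.ne_empty, if_pos ⟨hS, ε, hε⟩, zero_add, ← pow_add, ← h2, pow_add]
            norm_num
        · rw [if_neg hS.ne_empty, if_neg hS.ne_empty, if_neg fun h => hp h.2, mul_zero, add_zero]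
          apply expands_of_mem_degLT
          obtain ⟨x, hx⟩ := hS
          push Not at hp
          obtain ⟨y, hy, hxy⟩ := hp (D.aEdge x)
          have h1 := hc.circleCount_of_not_parallel ha hy hx hxy
          refine degLT_mono ?_ ht.mem_degLT
          rw [aCircleCount] at hv
          rw [hk, aCircleCount]
          push_cast
          omega)
  convert key using 1
  · simp
  · have e := sum_neg_one_pow_card_constant D.aEdge
    rw [Finset.sum_filter] at e
    rw [Finset.sum_add_distrib, ← Finset.mul_sum, e, hv]
    simp
    ring

end LinkDiagram

/-! ## Cablings of planar diagrams are planar -/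

namespace LinkDiagram

open Relation

variable {X : Type*} {D : LinkDiagram X} {n : ℕ}

theorem cable_edge_eq_iff {d e : (X × Fin n × Fin n) × Fin 4} :
    (D.cable n).edge d = e ↔ D.cableStep n (cableCoord X n d) = cableCoord X n e :=
  Equiv.symm_apply_eq _

theorem cable_edge_symm {d e : (X × Fin n × Fin n) × Fin 4} (h : (D.cable n).edge d = e) :
    (D.cable n).edge e = d := by
  rw [← h, (D.cable n).edge_edge]

/-- A half-edge of the cable on the border of a grid. -/
def border (d : X × Fin 4) (p : Fin (n + 1)) : (X × Fin (n + 1) × Fin (n + 1)) × Fin 4 :=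
  (cableCoord X (n + 1)).symm (d, (p, 0))

theorem border_zero (x : X) (p : Fin (n + 1)) : border (x, 0) p = ((x, p, 0), 0) := by
  simp [border, cableCoord, turn]

theorem border_one (x : X) (p : Fin (n + 1)) : border (x, 1) p = ((x, Fin.last n, p), 1) := by
  have : (-1 : Fin 4) = 3 := rfl
  simp [border, cableCoord, turn, this]

theorem border_two (x : X) (p : Fin (n + 1)) : border (x, 2) p = ((x, p.rev, Fin.last n), 2) := by
  have : (-2 : Fin 4) = 2 := rfl
  simp [border, cableCoord, turn, this]

theorem border_three (x : X) (p : Fin (n + 1)) : border (x, 3) p = ((x, 0, p.rev), 3) := by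
  have : (-3 : Fin 4) = 1 := rfl
  simp [border, cableCoord, turn, this]

theorem cable_edge_border (d : X × Fin 4) (p : Fin (n + 1)) :
    (D.cable (n + 1)).edge (border d p) = border (D.edge d) p.rev := by
  rw [cable_edge_eq_iff, border, border, Equiv.apply_symm_apply, Equiv.apply_symm_apply]
  simp [cableStep]

theorem cable_edge_down (x : X) (a : Fin (n + 1)) (b : Fin n) :
    (D.cable (n + 1)).edge ((x, a, b.succ), 0) = ((x, a, b.castSucc), 2) := by
  rw [cable_edge_eq_iff]
  simp [cableStep, cableCoord, turn, Fin.ext_iff]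

theorem cable_edge_left (x : X) (a : Fin n) (b : Fin (n + 1)) :
    (D.cable (n + 1)).edge ((x, a.succ, b), 3) = ((x, a.castSucc, b), 1) := by
  rw [cable_edge_eq_iff]
  simp [cableStep, cableCoord, turn, Fin.ext_iff]

/-- The half-edges of a cable: those on the border of a grid, and those inside. -/
theorem cable_dart_cases {P : (X × Fin (n + 1) × Fin (n + 1)) × Fin 4 → Prop}
    (h0 : ∀ d p, P (border d p)) (h1 : ∀ x a (b : Fin n), P ((x, a, b.succ), 0))
    (h2 : ∀ x a (b : Fin n), P ((x, a, b.castSucc), 2))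
    (h3 : ∀ x (a : Fin n) b, P ((x, a.succ, b), 3))
    (h4 : ∀ x (a : Fin n) b, P ((x, a.castSucc, b), 1)) (d) : P d := by
  obtain ⟨⟨x, a, b⟩, i⟩ := d
  fin_cases i
  · cases b using Fin.cases with
    | zero => exact border_zero x a ▸ h0 (x, 0) a
    | succ b => exact h1 x a b
  · cases a using Fin.lastCases with
    | last => exact border_one x b ▸ h0 (x, 1) b
    | cast a => exact h4 x a b
  · cases b using Fin.lastCases with
    | last =>
      have := h0 (x, 2) a.rev
      rwa [border_two, Fin.rev_rev] at this
    | cast b => exact h2 x a b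
  · cases a using Fin.cases with
    | zero =>
      have := h0 (x, 3) b.rev
      rwa [border_three, Fin.rev_rev] at this
    | succ a => exact h3 x a b

/-! ### Graph components of a cable -/

/-- Walking down and then left leads to the corner of the grid, so each grid is connected. -/
theorem cable_component_eq (x : X) (a b : Fin (n + 1)) (i : Fin 4) :
    (Quot.mk _ ((x, a, b), i) : (D.cable (n + 1)).GraphComponent) = Quot.mk _ ((x, 0, 0), 0) := by
  have h1 : ∀ a b i j, (Quot.mk _ ((x, a, b), i) : (D.cable (n + 1)).GraphComponent) =
      Quot.mk _ ((x, a, b), j) := fun a b i j => Quot.sound (Or.inl rfl)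
  have h2 : ∀ d, (Quot.mk _ d : (D.cable (n + 1)).GraphComponent) =
      Quot.mk _ ((D.cable (n + 1)).edge d) := fun d => Quot.sound (Or.inr rfl)
  have h3 : ∀ b, (Quot.mk _ ((x, a, b), i) : (D.cable (n + 1)).GraphComponent) =
      Quot.mk _ ((x, a, 0), 0) := by
    intro b
    induction b using Fin.induction with
    | zero => exact h1 _ _ _ _
    | succ b ih => rw [h1 _ _ i 0, h2, cable_edge_down, h1 _ _ 2 i, ih]
  rw [h3]
  clear h3
  induction a using Fin.induction with
  | zero => rfl
  | succ a ih => rw [h1 _ _ 0 3, h2, cable_edge_left, h1 _ _ 1 0, ih]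

theorem card_graphComponent_cable_le [Finite X] :
    Nat.card (D.cable (n + 1)).GraphComponent ≤ Nat.card D.GraphComponent := by
  let f : D.GraphComponent → (D.cable (n + 1)).GraphComponent :=
    Quot.lift (fun d => Quot.mk _ ((d.1, 0, 0), 0)) (by
      have h1 : ∀ x i p, (Quot.mk _ (border (x, i) p) : (D.cable (n + 1)).GraphComponent) =
          Quot.mk _ ((x, 0, 0), 0) := fun x i p => cable_component_eq _ _ _ _
      rintro ⟨x, i⟩ ⟨y, j⟩ (h | h)
      · obtain rfl : y = x := h
        rfl
      · have h2 : (Quot.mk _ (border (x, i) 0) : (D.cable (n + 1)).GraphComponent) =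
            Quot.mk _ ((D.cable (n + 1)).edge (border (x, i) 0)) := Quot.sound (Or.inr rfl)
        rw [h1, cable_edge_border, ← h, h1] at h2
        exact h2)
  refine Nat.card_le_card_of_surjective f ?_
  rintro ⟨⟨⟨x, a, b⟩, i⟩⟩
  exact ⟨Quot.mk _ (x, 0), (cable_component_eq x a b i).symm⟩

/-! ### Faces of a cable -/

theorem cableCoord_turn (d : (X × Fin n × Fin n) × Fin 4) :
    cableCoord X n (d.1, d.2 + 1) = (((cableCoord X n d).1.1, (cableCoord X n d).1.2 + 1),
      ((cableCoord X n d).2.2, (cableCoord X n d).2.1.rev)) := by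
  obtain ⟨⟨x, a, b⟩, i⟩ := d
  fin_cases i <;> simp [cableCoord, turn]

/-- The strips of a cable between two neighbouring parallel copies of an edge. -/
abbrev Strip (D : LinkDiagram X) (n : ℕ) : Type _ :=
  Quot fun u v : (X × Fin 4) × Fin n => v = (D.edge u.1, u.2.rev)

/-- The face of the cable at the corner clockwise of a half-edge: a face of the diagram, a strip
along an edge, or a square inside a grid. -/
def cableFace (D : LinkDiagram X) (n : ℕ) (u : (X × Fin 4) × (Fin (n + 1) × Fin (n + 1))) :
    D.Face ⊕ D.Strip n ⊕ X × Fin n × Fin n :=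
  -- At p = q = 0 the corner is a corner of the grid. For p = 0 < q it opens into the strip at the
  -- clockwise neighbouring side, whose numbering ends next to side i; for q = 0 < p into a strip at
  -- side i itself.
  Fin.cases (Fin.cases (Sum.inl (Quot.mk _ u.1))
      (fun q => Sum.inr (Sum.inl (Quot.mk _ ((u.1.1, u.1.2 + 3), q.rev)))) u.2.2)
    (fun p => Fin.cases (Sum.inr (Sum.inl (Quot.mk _ (u.1, p))))
      (fun q => Sum.inr (Sum.inr (u.1.1, turn (-u.1.2) (p, q)))) u.2.2) u.2.1

theorem cableFace_turn_step (u : (X × Fin 4) × (Fin (n + 1) × Fin (n + 1))) :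
    D.cableFace n (((D.cableStep (n + 1) u).1.1, (D.cableStep (n + 1) u).1.2 + 1),
      ((D.cableStep (n + 1) u).2.2, (D.cableStep (n + 1) u).2.1.rev)) = D.cableFace n u := by
  obtain ⟨⟨x, i⟩, p, q⟩ := u
  have e13 : ∀ j : Fin 4, j + 1 + 3 = j := by decide
  have e23 : i + 2 + 1 = i + 3 := by revert i; decide
  cases q using Fin.cases with
  | zero =>
    have hs : D.cableStep (n + 1) ((x, i), (p, 0)) = (D.edge (x, i), (p.rev, 0)) := by
      simp [cableStep]
    rw [hs, Fin.rev_rev]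
    cases p using Fin.cases with
    | zero => exact congrArg Sum.inl (face_mk_edge_turn _)
    | succ p =>
      refine congrArg (Sum.inr ∘ Sum.inl) ?_
      refine Eq.symm (Quot.sound ?_)
      rw [e13]
  | succ q =>
    have hs : D.cableStep (n + 1) ((x, i), (p, q.succ)) =
        ((x, i + 2), (p.rev, q.rev.succ)) := by
      simp [cableStep, Fin.ext_iff, Fin.val_rev]
      omega
    rw [hs, Fin.rev_rev, e23]
    cases p using Fin.cases with
    | zero => rfl
    | succ p =>
      refine congrArg (Sum.inr ∘ Sum.inr) ?_
      refine Prod.ext rfl ?_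
      have h0 : -(3 : Fin 4) = 1 := rfl
      have h1 : -(2 : Fin 4) = 2 := rfl
      have h2 : -(1 : Fin 4) = 3 := rfl
      fin_cases i <;> simp [turn, h0, h1, h2, Fin.ext_iff, Fin.val_rev] <;> omega

theorem card_strip [Finite X] : Nat.card (D.Strip n) = 2 * Nat.card X * n := by
  have := two_mul_card_quot_involution (α := (X × Fin 4) × Fin n)
    (g := fun u => (D.edge u.1, u.2.rev)) (fun u => by simp [D.edge_edge])
    (fun u h => D.edge_ne _ (congrArg Prod.fst h))
  rw [Nat.card_prod, Nat.card_prod, Nat.card_eq_fintype_card (α := Fin 4), Fintype.card_fin,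
    Nat.card_eq_fintype_card (α := Fin n), Fintype.card_fin] at this
  change Nat.card (Quot _) = _
  nlinarith

/-- `cableFace` is constant on faces of the cable and takes every value. This one inequality is
enough, since `isHomPlanar_of_card_le` needs only a lower bound for the number of faces. -/
theorem le_card_face_cable [Finite X] :
    Nat.card D.Face + 2 * Nat.card X * n + Nat.card X * n ^ 2 ≤
      Nat.card (D.cable (n + 1)).Face := by
  have h1 : Nat.card (D.Face ⊕ D.Strip n ⊕ X × Fin n × Fin n) =
      Nat.card D.Face + 2 * Nat.card X * n + Nat.card X * n ^ 2 := by
    rw [Nat.card_sum, Nat.card_sum, card_strip, Nat.card_prod, Nat.card_prod,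
      Nat.card_eq_fintype_card (α := Fin n), Fintype.card_fin]
    ring
  rw [← h1]
  let f : (D.cable (n + 1)).Face → D.Face ⊕ D.Strip n ⊕ X × Fin n × Fin n :=
    Quot.lift (fun d => D.cableFace n (cableCoord X (n + 1) d)) (by
      rintro d e rfl
      rw [cableCoord_turn]
      have : cableCoord X (n + 1) ((D.cable (n + 1)).edge d) =
        D.cableStep (n + 1) (cableCoord X (n + 1) d) := (cable_edge_eq_iff.1 rfl).symm
      rw [this, cableFace_turn_step])
  have hf : ∀ u w, D.cableFace n u = w → ∃ F, f F = w := fun u w h =>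
    ⟨Quot.mk _ ((cableCoord X (n + 1)).symm u), by simpa [f] using h⟩
  refine Nat.card_le_card_of_surjective f ?_
  rintro (F | S | ⟨x, p, q⟩)
  · induction F using Quot.ind with
    | mk d => exact hf (d, (0, 0)) _ rfl
  · induction S using Quot.ind with
    | mk u => exact hf (u.1, (u.2.succ, 0)) _ rfl
  · exact hf ((x, 0), (p.succ, q.succ)) _ (by simp [cableFace, turn])

/-- With V crossings the strips and squares number 2Vn + Vn² = V(n + 1)² - V, which is the growth in
crossings, while the number of components does not grow. -/
theorem IsPlanar.isHomPlanar_cable [Finite X] (h : D.IsPlanar) :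
    (D.cable (n + 1)).IsHomPlanar := by
  refine isHomPlanar_of_card_le ?_
  have h1 := D.le_card_face_cable (n := n)
  have h2 := D.card_graphComponent_cable_le (n := n)
  have h3 : Nat.card D.Face = _ := h
  have h4 : Nat.card (X × Fin (n + 1) × Fin (n + 1)) = Nat.card X * (n + 1) ^ 2 := by
    rw [Nat.card_prod, Nat.card_prod, Nat.card_eq_fintype_card (α := Fin (n + 1)),
      Fintype.card_fin]
    ring
  rw [h4]
  nlinarith

end LinkDiagram

/-! ## The all-`A` state of a cable -/

namespace LinkDiagram

open Relation

variable {X : Type*} {D : LinkDiagram X} {n : ℕ} {c : X × Fin 4 → ZMod 2}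

/-- The numbering of parallel strands, reversed where the colour is nonzero. -/
def twist (κ : ZMod 2) (u : Fin n) : Fin n := if κ = 0 then u else u.rev

theorem twist_twist (κ : ZMod 2) (u : Fin n) : twist κ (twist κ u) = u := by
  unfold twist; split_ifs <;> simp

/-- Edges and splicings flip the colour and also reverse the counterclockwise numbering of strands.
Hence `twist (c d) p` is a consistent number for the parallel copies of a circle. -/
theorem twist_add_one (κ : ZMod 2) (u : Fin n) : twist (κ + 1) u.rev = twist κ u := by
  have h : κ = 0 ∨ κ = 1 := by revert κ; decide
  have h2 : (1 + 1 : ZMod 2) = 0 := rfl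
  rcases h with rfl | rfl <;> simp [twist, h2]

theorem twist_rev (κ : ZMod 2) (u : Fin n) : twist (κ + 1) u = (twist κ u).rev := by
  have h : κ = 0 ∨ κ = 1 := by revert κ; decide
  have h2 : (1 + 1 : ZMod 2) = 0 := rfl
  rcases h with rfl | rfl <;> simp [twist, h2]

/-- The position of the lower right (`hi = false`) or upper left (`hi = true`) arc of the
`A`-splicing at the crossing `(a, b)` of a grid: it belongs to the circles parallel to the arc at
side `0` or to the arc at side `2`, with the given number of circles between it and the diagonal. -/
def gridDepth (a b : Fin (n + 1)) : Bool → Fin 4 × Fin (n + 1)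
  | false => if b ≤ a then (0, ⟨a - b, by omega⟩) else (2, ⟨b - a - 1, by omega⟩)
  | true => if b < a then (0, ⟨a - b - 1, by omega⟩) else (2, ⟨b - a, by omega⟩)

/-- Whether a half-edge belongs to the upper left arc of the `A`-splicing. -/
def isUpper : Fin 4 → Bool := ![false, false, true, true]

theorem gridDepth_down (a : Fin (n + 1)) (b : Fin n) :
    gridDepth a b.succ false = gridDepth a b.castSucc true := by
  have h1 : b.succ ≤ a ↔ b.castSucc < a := by simp [Fin.le_def, Fin.lt_def]
  simp only [gridDepth, h1]
  split_ifs with h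
  · simp [Fin.ext_iff]; omega
  · simp [Fin.ext_iff]; omega

theorem gridDepth_left (a : Fin n) (b : Fin (n + 1)) :
    gridDepth a.succ b true = gridDepth a.castSucc b false := by
  have h1 : b < a.succ ↔ b ≤ a.castSucc := by simp [Fin.le_def, Fin.lt_def]
  simp only [gridDepth, h1]
  split_ifs with h
  · simp [Fin.ext_iff]; omega
  · simp [Fin.ext_iff]; omega

/-- The circle of the all-`A` state of the diagram to which the circle of the cable through a
half-edge is parallel, and its number among the parallel circles. -/
def cableLabel (D : LinkDiagram X) (c : X × Fin 4 → ZMod 2)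
    (d : (X × Fin (n + 1) × Fin (n + 1)) × Fin 4) :
    Quot (D.stateRel fun _ => true) × Fin (n + 1) :=
  (Quot.mk _ (d.1.1, (gridDepth d.1.2.1 d.1.2.2 (isUpper d.2)).1),
    twist (c (d.1.1, 0)) (gridDepth d.1.2.1 d.1.2.2 (isUpper d.2)).2)

theorem IsCheckerboard.cableLabel_border (hc : D.IsCheckerboard c) (d : X × Fin 4)
    (p : Fin (n + 1)) : D.cableLabel c (border d p) = (Quot.mk _ d, twist (c d) p) := by
  obtain ⟨x, i⟩ := d
  have c1 : c (x, 1) = c (x, 0) + 1 := hc.turn x 0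
  have c2 : c (x, 2) = c (x, 1) + 1 := hc.turn x 1
  have c3 : c (x, 3) = c (x, 2) + 1 := hc.turn x 2
  have h01 : (Quot.mk _ (x, 0) : Quot (D.stateRel fun _ => true)) = Quot.mk _ (x, 1) :=
    Quot.eqvGen_sound (sameCircle_splice' rfl 0)
  have h23 : (Quot.mk _ (x, 2) : Quot (D.stateRel fun _ => true)) = Quot.mk _ (x, 3) :=
    Quot.eqvGen_sound (sameCircle_splice' rfl 2)
  have z2 : ∀ u : ZMod 2, u + 1 + 1 = u := by decide
  have hp : (p : ℕ) < n + 1 := p.2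
  fin_cases i
  · have : gridDepth p 0 false = (0, p) := by
      simp [gridDepth]
    simp [border_zero, cableLabel, isUpper, this]
  · have : gridDepth (Fin.last n) p false = (0, p.rev) := by
      simp only [gridDepth, Fin.le_last, if_true]
      exact Prod.ext rfl (Fin.ext (by simp [Fin.val_rev]))
    simp only [border_one, cableLabel, isUpper, Fin.mk_one, Matrix.cons_val, this, h01, c1,
      twist_rev, ← twist_add_one (c (x, 0)) p.rev, Fin.rev_rev]
  · have : gridDepth p.rev (Fin.last n) true = (2, p) := by
      have h : ¬ Fin.last n < p.rev := not_lt.2 (Fin.le_last _)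
      simp only [gridDepth, h, if_false]
      exact Prod.ext rfl (Fin.ext (by simp [Fin.val_rev]; omega))
    simp only [Fin.reduceFinMk, border_two, cableLabel, isUpper, Matrix.cons_val, this, c2, c1, z2]
  · have : gridDepth 0 p.rev true = (2, p.rev) := by
      simp only [gridDepth, Fin.not_lt_zero, if_false]
      exact Prod.ext rfl (Fin.ext (by simp))
    simp only [Fin.reduceFinMk, border_three, cableLabel, isUpper, Matrix.cons_val, this, h23, c3,
      c2, c1, z2, twist_rev, ← twist_add_one (c (x, 0)) p.rev, Fin.rev_rev]

theorem IsCheckerboard.cableLabel_eq (hc : D.IsCheckerboard c)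
    {d e : (X × Fin (n + 1) × Fin (n + 1)) × Fin 4}
    (h : (D.cable (n + 1)).SameCircle (fun _ => true) d e) :
    D.cableLabel c d = D.cableLabel c e := by
  have hdown : ∀ x a (b : Fin n), D.cableLabel c ((x, a, b.succ), 0) =
      D.cableLabel c ((x, a, b.castSucc), 2) := by
    intro x a b
    simp only [cableLabel, isUpper, Matrix.cons_val, gridDepth_down]
  have hleft : ∀ x (a : Fin n) b, D.cableLabel c ((x, a.succ, b), 3) =
      D.cableLabel c ((x, a.castSucc, b), 1) := by
    intro x a b
    simp only [cableLabel, isUpper, Matrix.cons_val, gridDepth_left]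
  refine h.apply_eq (fun d => ?_) (fun x i => ?_)
  · induction d using cable_dart_cases (n := n) with
    | h0 d p =>
      rw [cable_edge_border, hc.cableLabel_border, hc.cableLabel_border, hc.edge, twist_add_one]
      exact Prod.ext (Quot.eqvGen_sound (sameCircle_edge _ d).symm) rfl
    | h1 x a b => rw [cable_edge_down, hdown]
    | h2 x a b => rw [cable_edge_symm (cable_edge_down x a b), hdown]
    | h3 x a b => rw [cable_edge_left, hleft]
    | h4 x a b => rw [cable_edge_symm (cable_edge_left x a b), hleft]
  · fin_cases i <;> rfl

/-- The circle of the all-`A` state of the cable through a half-edge. -/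
abbrev cableCircle (D : LinkDiagram X) (d : (X × Fin (n + 1) × Fin (n + 1)) × Fin 4) :
    Quot ((D.cable (n + 1)).stateRel fun _ => true) := Quot.mk _ d

theorem cableCircle_edge (d : (X × Fin (n + 1) × Fin (n + 1)) × Fin 4) :
    D.cableCircle ((D.cable (n + 1)).edge d) = D.cableCircle d :=
  Quot.eqvGen_sound (sameCircle_edge _ d).symm

theorem cableCircle_lower (u : X × Fin (n + 1) × Fin (n + 1)) :
    D.cableCircle (u, 1) = D.cableCircle (u, 0) :=
  Quot.eqvGen_sound (sameCircle_splice' rfl 1)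

theorem cableCircle_upper (u : X × Fin (n + 1) × Fin (n + 1)) :
    D.cableCircle (u, 3) = D.cableCircle (u, 2) :=
  Quot.eqvGen_sound (sameCircle_splice' rfl 3)

theorem cableCircle_down (x : X) (a : Fin (n + 1)) (b : Fin n) :
    D.cableCircle ((x, a, b.succ), 0) = D.cableCircle ((x, a, b.castSucc), 2) := by
  rw [← cable_edge_down (D := D), cableCircle_edge]

theorem cableCircle_left (x : X) (a : Fin n) (b : Fin (n + 1)) :
    D.cableCircle ((x, a.succ, b), 2) = D.cableCircle ((x, a.castSucc, b), 0) := by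
  rw [← cableCircle_upper, ← cableCircle_lower, ← cable_edge_left (D := D), cableCircle_edge]

/-- In the all-A state the arcs inside a grid link up to staircases parallel to the diagonal a = b.
-/
theorem cableCircle_diag_lower (x : X) (a b : Fin n) :
    D.cableCircle ((x, a.succ, b.succ), 0) = D.cableCircle ((x, a.castSucc, b.castSucc), 0) := by
  rw [cableCircle_down, cableCircle_left]

theorem cableCircle_diag_upper (x : X) (a b : Fin n) :
    D.cableCircle ((x, a.succ, b.succ), 2) = D.cableCircle ((x, a.castSucc, b.castSucc), 2) := by
  rw [cableCircle_left, cableCircle_down]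

theorem cableCircle_diag_add (x : X) (i : Fin 4) (hi : i = 0 ∨ i = 2) (k a b : ℕ)
    (ha : a + k < n + 1) (hb : b + k < n + 1) :
    D.cableCircle ((x, ⟨a + k, ha⟩, ⟨b + k, hb⟩), i) =
      D.cableCircle ((x, ⟨a, by omega⟩, ⟨b, by omega⟩), i) := by
  induction k with
  | zero => rfl
  | succ k ih =>
    refine Eq.trans ?_ (ih (by omega) (by omega))
    rcases hi with rfl | rfl
    · exact cableCircle_diag_lower x ⟨a + k, by omega⟩ ⟨b + k, by omega⟩
    · exact cableCircle_diag_upper x ⟨a + k, by omega⟩ ⟨b + k, by omega⟩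

theorem cableCircle_border_splice (x : X) (i : Fin 4) (p : Fin (n + 1)) :
    D.cableCircle (border (x, splice true i) p.rev) = D.cableCircle (border (x, i) p) := by
  have h1 : ∀ p : Fin (n + 1), D.cableCircle (border (x, 1) p.rev) =
      D.cableCircle (border (x, 0) p) := by
    intro p
    have hp := p.2
    rw [border_one, border_zero, cableCircle_lower]
    refine Eq.trans ?_ (cableCircle_diag_add x 0 (Or.inl rfl) (n - p) p 0 (by omega) (by omega))
    congr 4 <;> simp [Fin.ext_iff, Fin.val_rev]
    omega
  have h2 : ∀ p : Fin (n + 1), D.cableCircle (border (x, 3) p.rev) =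
      D.cableCircle (border (x, 2) p) := by
    intro p
    have hp := p.2
    rw [border_three, border_two, cableCircle_upper, Fin.rev_rev]
    refine (cableCircle_diag_add x 2 (Or.inr rfl) (n - p) 0 p (by omega) (by omega)).symm.trans ?_
    congr 4 <;> simp [Fin.ext_iff, Fin.val_rev]
    omega
  fin_cases i
  · exact h1 p
  · have := h1 p.rev
    rw [Fin.rev_rev] at this
    exact this.symm
  · exact h2 p
  · have := h2 p.rev
    rw [Fin.rev_rev] at this
    exact this.symm

/-- A staircase followed downwards leaves the grid at the bottom or on the left, so no circle is
confined to a grid. -/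
theorem exists_border (d : (X × Fin (n + 1) × Fin (n + 1)) × Fin 4) :
    ∃ e p, D.cableCircle d = D.cableCircle (border e p) := by
  obtain ⟨⟨x, a, b⟩, i⟩ := d
  have hlow : ∃ e p, D.cableCircle ((x, a, b), 0) = D.cableCircle (border e p) := by
    obtain ⟨a, ha⟩ := a
    obtain ⟨b, hb⟩ := b
    rcases le_or_gt b a with h | h
    · obtain ⟨k, rfl⟩ := Nat.exists_eq_add_of_le h
      refine ⟨(x, 0), ⟨k, by omega⟩, ?_⟩
      rw [border_zero]
      refine Eq.trans ?_
        (cableCircle_diag_add x 0 (Or.inl rfl) b k 0 (by omega) (by omega))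
      congr 4 <;> simp [add_comm]
    · obtain ⟨k, rfl⟩ := Nat.exists_eq_add_of_lt h
      refine ⟨(x, 3), (⟨k, by omega⟩ : Fin (n + 1)).rev, ?_⟩
      rw [border_three, Fin.rev_rev, cableCircle_upper]
      have h1 := cableCircle_down (D := D) x 0 (⟨k, by omega⟩ : Fin n)
      refine Eq.trans (Eq.trans ?_
        (cableCircle_diag_add x 0 (Or.inl rfl) a 0 (k + 1) (by omega) (by omega))) h1
      congr 4 <;> simp [add_comm, add_assoc]
  have hupp : ∃ e p, D.cableCircle ((x, a, b), 2) = D.cableCircle (border e p) := by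
    clear hlow
    obtain ⟨a, ha⟩ := a
    obtain ⟨b, hb⟩ := b
    rcases le_or_gt a b with h | h
    · obtain ⟨k, rfl⟩ := Nat.exists_eq_add_of_le h
      refine ⟨(x, 3), (⟨k, by omega⟩ : Fin (n + 1)).rev, ?_⟩
      rw [border_three, Fin.rev_rev, cableCircle_upper]
      refine Eq.trans ?_
        (cableCircle_diag_add x 2 (Or.inr rfl) a 0 k (by omega) (by omega))
      congr 4 <;> simp [add_comm]
    · obtain ⟨k, rfl⟩ := Nat.exists_eq_add_of_lt h
      refine ⟨(x, 0), (⟨k, by omega⟩ : Fin (n + 1)), ?_⟩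
      rw [border_zero]
      have h1 := cableCircle_left (D := D) x (⟨k, by omega⟩ : Fin n) 0
      refine Eq.trans (Eq.trans ?_
        (cableCircle_diag_add x 2 (Or.inr rfl) b (k + 1) 0 (by omega) (by omega))) h1
      congr 4 <;> simp [add_comm, add_assoc]
  fin_cases i
  · exact hlow
  · simpa only [Fin.mk_one, cableCircle_lower] using hlow
  · exact hupp
  · simpa only [Fin.reduceFinMk, cableCircle_upper] using hupp

/-- The circles of the all-`A` state of a cable are the parallel copies of the circles of the
all-`A` state of the diagram. -/
noncomputable def IsCheckerboard.cableCircleEquiv (hc : D.IsCheckerboard c) (n : ℕ) :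
    Quot ((D.cable (n + 1)).stateRel fun _ => true) ≃
      Quot (D.stateRel fun _ => true) × Fin (n + 1) where
  toFun := Quot.lift (D.cableLabel c) fun _ _ h => hc.cableLabel_eq (.rel _ _ h)
  invFun q := Quot.lift (fun d => D.cableCircle (border d (twist (c d) q.2))) (by
    rintro d e (rfl | rfl)
    · simp only [hc.edge, twist_rev]
      rw [← cable_edge_border, cableCircle_edge]
    · simp only [hc.splice, twist_rev]
      rw [cableCircle_border_splice]) q.1
  left_inv := by
    rintro ⟨d⟩
    obtain ⟨e, p, h⟩ := exists_border (D := D) d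
    have h' : (Quot.mk _ d : Quot ((D.cable (n + 1)).stateRel fun _ => true)) =
      Quot.mk _ (border e p) := h
    rw [h']
    simp only [hc.cableLabel_border, twist_twist]
  right_inv := by
    rintro ⟨⟨d⟩, p⟩
    simp only [hc.cableLabel_border, twist_twist]

theorem IsCheckerboard.sameCircle_cable_iff (hc : D.IsCheckerboard c)
    {d e : (X × Fin (n + 1) × Fin (n + 1)) × Fin 4} :
    (D.cable (n + 1)).SameCircle (fun _ => true) d e ↔ D.cableLabel c d = D.cableLabel c e :=
  ⟨hc.cableLabel_eq, fun h => Quot.eqvGen_exact ((hc.cableCircleEquiv n).injective h)⟩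

theorem IsCheckerboard.aCircleCount_cable [Finite X] (hc : D.IsCheckerboard c) :
    (D.cable (n + 1)).aCircleCount = (n + 1) * D.aCircleCount := by
  rw [aCircleCount, aCircleCount, circleCount, Nat.card_congr (hc.cableCircleEquiv n),
    Nat.card_prod, Nat.card_eq_fintype_card (α := Fin (n + 1)), Fintype.card_fin, cable]
  ring

end LinkDiagram

/-! ## The reduced `A`-graph of a cable -/

namespace LinkDiagram

open Relation

variable {X : Type*} {D : LinkDiagram X} {n : ℕ} {c : X × Fin 4 → ZMod 2}

/-- The pair of neighbouring parallel copies, with numbers `i` and `i + 1`, of a circle. -/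
def chainEdge {Q : Type*} (q : Q × Fin n) : Sym2 (Q × Fin (n + 1)) :=
  s((q.1, q.2.castSucc), (q.1, q.2.succ))

theorem chainEdge_injective {Q : Type*} : Function.Injective (chainEdge : Q × Fin n → _) := by
  rintro ⟨q, i⟩ ⟨r, j⟩ h
  simp only [chainEdge, Sym2.eq_iff, Prod.mk.injEq, Fin.ext_iff, Fin.val_castSucc,
    Fin.val_succ] at h
  rcases h with ⟨⟨rfl, h1⟩, -⟩ | ⟨⟨rfl, h1⟩, -, h2⟩
  · exact Prod.ext rfl (Fin.ext h1)
  · omega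

theorem mk_twist_eq_chainEdge {Q : Type*} (q : Q) (κ : ZMod 2) (t : Fin n) :
    s((q, twist κ t.succ), (q, twist κ t.castSucc)) = chainEdge (q, twist κ t) := by
  unfold twist chainEdge
  split_ifs
  · exact Sym2.eq_swap
  · simp only [Fin.rev_succ, Fin.rev_castSucc]

/-- The two circles of the all-`A` state of a cable that meet at a crossing. -/
def cableEdge (D : LinkDiagram X) (c : X × Fin 4 → ZMod 2) (u : X × Fin (n + 1) × Fin (n + 1)) :
    Sym2 (Quot (D.stateRel fun _ => true) × Fin (n + 1)) :=
  s(D.cableLabel c (u, 0), D.cableLabel c (u, 2))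

/-- The two circles that meet at the crossings on the diagonal of the grid at `x`. -/
def diagEdge (D : LinkDiagram X) (n : ℕ) (c : X × Fin 4 → ZMod 2) (x : X) :
    Sym2 (Quot (D.stateRel fun _ => true) × Fin (n + 1)) :=
  s((Quot.mk _ (x, 0), twist (c (x, 0)) 0), (Quot.mk _ (x, 2), twist (c (x, 0)) 0))

theorem cableEdge_of_lt (x : X) {a b : Fin (n + 1)} (h : b < a) :
    D.cableEdge c (x, a, b) =
      chainEdge (Quot.mk _ (x, 0), twist (c (x, 0)) ⟨a - b - 1, by omega⟩) := by
  rw [← mk_twist_eq_chainEdge]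
  have h1 : (⟨a - b, by omega⟩ : Fin (n + 1)) = (⟨a - b - 1, by omega⟩ : Fin n).succ := by
    simp only [Fin.ext_iff, Fin.val_succ]
    omega
  simp only [cableEdge, cableLabel, gridDepth, isUpper, Matrix.cons_val, h, h.le, if_true, h1]
  rfl

theorem cableEdge_of_gt (x : X) {a b : Fin (n + 1)} (h : a < b) :
    D.cableEdge c (x, a, b) =
      chainEdge (Quot.mk _ (x, 2), twist (c (x, 0)) ⟨b - a - 1, by omega⟩) := by
  rw [← mk_twist_eq_chainEdge, Sym2.eq_swap]
  have h1 : (⟨b - a, by omega⟩ : Fin (n + 1)) = (⟨b - a - 1, by omega⟩ : Fin n).succ := by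
    simp only [Fin.ext_iff, Fin.val_succ]
    omega
  simp only [cableEdge, cableLabel, gridDepth, isUpper, Matrix.cons_val, h.not_gt, h.not_ge,
    if_false, h1]
  rfl

theorem cableEdge_self (x : X) (a : Fin (n + 1)) :
    D.cableEdge c (x, a, a) = D.diagEdge n c x := by
  simp [cableEdge, cableLabel, gridDepth, isUpper, diagEdge]

/-- Off the diagonal a crossing joins consecutive copies of one circle; on the diagonal it joins
copies of two circles that are distinct because `D` is adequate. -/
theorem IsCheckerboard.isAAdequate_cable (hc : D.IsCheckerboard c) (ha : D.IsAAdequate) :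
    (D.cable (n + 1)).IsAAdequate := by
  refine isAAdequate_of_not_sameCircle fun u h => ?_
  have h1 := hc.sameCircle_cable_iff.1 h
  have h2 : (D.cableEdge c u).IsDiag := h1
  obtain ⟨x, a, b⟩ := u
  rcases lt_trichotomy b a with hab | rfl | hab
  · rw [cableEdge_of_lt x hab] at h2
    simp [chainEdge, Fin.ext_iff] at h2
  · rw [cableEdge_self] at h2
    have h3 : (Quot.mk _ (x, 0) : Quot (D.stateRel fun _ => true)) = Quot.mk _ (x, 2) :=
      congrArg Prod.fst (Sym2.mk_isDiag_iff.1 h2)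
    exact ha.not_sameCircle x (Quot.eqvGen_exact h3)
  · rw [cableEdge_of_gt x hab] at h2
    simp [chainEdge, Fin.ext_iff] at h2

theorem IsCheckerboard.aEdge_cable_eq_iff (hc : D.IsCheckerboard c)
    {u w : X × Fin (n + 1) × Fin (n + 1)} :
    (D.cable (n + 1)).aEdge u = (D.cable (n + 1)).aEdge w ↔
      D.cableEdge c u = D.cableEdge c w := by
  rw [aEdge_eq_iff, cableEdge, cableEdge, Sym2.eq_iff]
  simp only [hc.sameCircle_cable_iff]

/-- Which extreme copies the diagonal joins depends on the colour at the crossing. Parallel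
crossings lie on the same side of their circles and so have equal colour: parallel edges stay
parallel in the cable. -/
theorem IsHomPlanar.diagEdge_eq_iff (h : D.IsHomPlanar) (hc : D.IsCheckerboard c)
    (ha : D.IsAAdequate) {x y : X} : D.diagEdge n c x = D.diagEdge n c y ↔ D.aEdge x = D.aEdge y := by
  constructor
  · intro hxy
    rw [aEdge_eq_iff]
    rcases Sym2.eq_iff.1 hxy with ⟨h1, h2⟩ | ⟨h1, h2⟩
    · exact Or.inl ⟨Quot.eqvGen_exact (congrArg Prod.fst h1),
        Quot.eqvGen_exact (congrArg Prod.fst h2)⟩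
    · exact Or.inr ⟨Quot.eqvGen_exact (congrArg Prod.fst h1),
        Quot.eqvGen_exact (congrArg Prod.fst h2)⟩
  · intro hxy
    have hcol := h.color_eq_of_parallel hc rfl rfl (ha.not_sameCircle x) (aEdge_eq_iff.1 hxy)
    rw [diagEdge, diagEdge, hcol, Sym2.eq_iff]
    rcases aEdge_eq_iff.1 hxy with ⟨h1, h2⟩ | ⟨h1, h2⟩
    · exact Or.inl ⟨by rw [Quot.eqvGen_sound h1], by rw [Quot.eqvGen_sound h2]⟩
    · exact Or.inr ⟨by rw [Quot.eqvGen_sound h1], by rw [Quot.eqvGen_sound h2]⟩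

theorem card_image_eq_of_eq_iff {α β γ : Type*} [DecidableEq β] [DecidableEq γ] (s : Finset α)
    {f : α → β} {g : α → γ} (h : ∀ x y, f x = f y ↔ g x = g y) :
    (s.image f).card = (s.image g).card := by
  classical
  refine Finset.card_bij' (fun b hb => g (Finset.mem_image.1 hb).choose)
    (fun b hb => f (Finset.mem_image.1 hb).choose) ?_ ?_ ?_ ?_
  · intro b hb
    exact Finset.mem_image_of_mem _ (Finset.mem_image.1 hb).choose_spec.1
  · intro b hb
    exact Finset.mem_image_of_mem _ (Finset.mem_image.1 hb).choose_spec.1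
  · intro b hb
    have h1 := (Finset.mem_image.1 hb).choose_spec.2
    generalize_proofs p q
    refine Eq.trans ?_ h1
    rw [h]
    exact q.choose_spec.2
  · intro b hb
    have h1 := (Finset.mem_image.1 hb).choose_spec.2
    generalize_proofs p q
    refine Eq.trans ?_ h1
    rw [← h]
    exact q.choose_spec.2

open Classical in
/-- The number of edges of the reduced `A`-graph of a cable. -/
theorem IsHomPlanar.card_image_aEdge_cable [Fintype X] (h : D.IsHomPlanar) (ha : D.IsAAdequate) :
    (Finset.univ.image (D.cable (n + 1)).aEdge).card =
      (Finset.univ.image D.aEdge).card + n * D.circleCount fun _ => true := by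
  obtain ⟨c, hc⟩ := h.exists_isCheckerboard
  have := Fintype.ofFinite (Quot (D.stateRel fun _ => true))
  rw [card_image_eq_of_eq_iff _ fun u w => hc.aEdge_cable_eq_iff (u := u) (w := w)]
  have himg : Finset.univ.image (D.cableEdge (n := n) c) =
      Finset.univ.image (D.diagEdge n c) ∪ Finset.univ.image chainEdge := by
    ext e
    simp only [Finset.mem_union, Finset.mem_image, Finset.mem_univ, true_and]
    constructor
    · rintro ⟨⟨x, a, b⟩, rfl⟩
      rcases lt_trichotomy b a with hab | rfl | hab
      · exact Or.inr ⟨_, (cableEdge_of_lt x hab).symm⟩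
      · exact Or.inl ⟨x, (cableEdge_self x b).symm⟩
      · exact Or.inr ⟨_, (cableEdge_of_gt x hab).symm⟩
    · rintro (⟨x, rfl⟩ | ⟨⟨q, t⟩, rfl⟩)
      · exact ⟨(x, 0, 0), cableEdge_self x 0⟩
      · have hq : ∃ x, q = Quot.mk _ (x, 0) ∨ q = Quot.mk _ (x, 2) := by
          induction q using Quot.ind with
          | mk d =>
            obtain ⟨x, i⟩ := d
            refine ⟨x, ?_⟩
            fin_cases i
            · exact Or.inl rfl
            · exact Or.inl (Quot.eqvGen_sound (sameCircle_splice' rfl 1))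
            · exact Or.inr rfl
            · exact Or.inr (Quot.eqvGen_sound (sameCircle_splice' rfl 3))
        obtain ⟨x, rfl | rfl⟩ := hq
        · refine ⟨(x, (twist (c (x, 0)) t).succ, 0), ?_⟩
          rw [cableEdge_of_lt x (Fin.succ_pos _)]
          congr 2
          refine Eq.trans (congrArg _ (Fin.ext ?_)) (twist_twist (c (x, 0)) t)
          simp
        · refine ⟨(x, 0, (twist (c (x, 0)) t).succ), ?_⟩
          rw [cableEdge_of_gt x (Fin.succ_pos _)]
          congr 2
          refine Eq.trans (congrArg _ (Fin.ext ?_)) (twist_twist (c (x, 0)) t)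
          simp
  rw [himg, Finset.card_union_of_disjoint]
  · rw [card_image_eq_of_eq_iff _ fun x y => h.diagEdge_eq_iff hc ha (x := x) (y := y),
      Finset.card_image_of_injective _ chainEdge_injective, Finset.card_univ, Fintype.card_prod,
      Fintype.card_fin, circleCount, Nat.card_eq_fintype_card, mul_comm n]
  · rw [Finset.disjoint_left]
    intro e h1 h2
    obtain ⟨x, -, rfl⟩ := Finset.mem_image.1 h1
    obtain ⟨⟨q, t⟩, -, hq⟩ := Finset.mem_image.1 h2
    have h3 : (Quot.mk _ (x, 0) : Quot (D.stateRel fun _ => true)) = Quot.mk _ (x, 2) := by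
      rcases Sym2.eq_iff.1 hq with ⟨e1, e2⟩ | ⟨e1, e2⟩
      · exact (congrArg Prod.fst e1).symm.trans (congrArg Prod.fst e2)
      · exact (congrArg Prod.fst e2).symm.trans (congrArg Prod.fst e1)
    exact ha.not_sameCircle x (Quot.eqvGen_exact h3)

end LinkDiagram

/-! ## The first Betti number of a connected graph -/

namespace SimpleGraph

variable {V : Type*} (G : SimpleGraph V)

/-- The space of rational 1-chains of a graph. -/
def chainSpaceQ : Submodule ℚ (V → V → ℚ) where
  carrier := {f | (∀ u v, f u v = - f v u) ∧ ∀ u v, ¬ G.Adj u v → f u v = 0}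
  zero_mem' := by simp
  add_mem' := by
    rintro f g ⟨hf1, hf2⟩ ⟨hg1, hg2⟩
    refine ⟨fun u v => ?_, fun u v h => by simp [hf2 u v h, hg2 u v h]⟩
    simp only [Pi.add_apply]
    rw [hf1 u v, hg1 u v]
    ring
  smul_mem' := by
    rintro a f ⟨hf1, hf2⟩
    refine ⟨fun u v => ?_, fun u v h => by simp [hf2 u v h]⟩
    simp only [Pi.smul_apply, smul_eq_mul]
    rw [hf1 u v]
    ring

/-- `Quot.out` orients every edge, and an antisymmetric chain is freely determined by its values on
the oriented edges. -/
theorem finrank_chainSpaceQ [Finite V] : Module.finrank ℚ G.chainSpaceQ = Nat.card G.edgeSet := by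
  classical
  have := Fintype.ofFinite G.edgeSet
  have hout : ∀ u v : V, (Quot.out s(u, v) = (u, v)) ∨ (Quot.out s(u, v) = (v, u)) := by
    intro u v
    have h : Quot.mk _ (Quot.out s(u, v)) = s(u, v) := Quot.out_eq _
    generalize Quot.out s(u, v) = p at h ⊢
    rcases Sym2.eq_iff.1 (show s(p.1, p.2) = s(u, v) from h) with ⟨h1, h2⟩ | ⟨h1, h2⟩
    · exact Or.inl (Prod.ext h1 h2)
    · exact Or.inr (Prod.ext h1 h2)
  let Φ : G.chainSpaceQ →ₗ[ℚ] (G.edgeSet → ℚ) :=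
    { toFun := fun f e => f.1 (Quot.out e.1).1 (Quot.out e.1).2
      map_add' := fun _ _ => rfl
      map_smul' := fun _ _ => rfl }
  have hΦ : Function.Bijective Φ := by
    constructor
    · rw [injective_iff_map_eq_zero]
      rintro ⟨f, hf1, hf2⟩ h
      apply Subtype.ext
      funext u v
      by_cases huv : G.Adj u v
      · have h1 : f (Quot.out s(u, v)).1 (Quot.out s(u, v)).2 = 0 := congrFun h ⟨s(u, v), huv⟩
        rcases hout u v with h2 | h2
        · rwa [h2] at h1
        · rw [h2] at h1
          change f u v = 0
          rw [hf1, h1, neg_zero]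
      · exact hf2 u v huv
    · intro g
      refine ⟨⟨fun u v => if h : G.Adj u v then
        (if Quot.out s(u, v) = (u, v) then g ⟨s(u, v), h⟩ else - g ⟨s(u, v), h⟩) else 0, ?_, ?_⟩, ?_⟩
      · intro u v
        by_cases h : G.Adj u v
        · have hne : u ≠ v := h.ne
          have hsw' : s(v, u) = s(u, v) := Sym2.eq_swap
          simp only [h, h.symm, dif_pos, hsw']
          rcases hout u v with h2 | h2 <;> simp [h2, hne, hne.symm]
        · have h' : ¬ G.Adj v u := fun h' => h h'.symm
          simp [h, h']
      · intro u v h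
        simp [h]
      · funext e
        obtain ⟨e, he⟩ := e
        have h1 : s((Quot.out e).1, (Quot.out e).2) = e := Quot.out_eq e
        have h2 : G.Adj (Quot.out e).1 (Quot.out e).2 := by
          rw [← h1] at he
          exact he
        simp only [Φ, LinearMap.coe_mk, AddHom.coe_mk, h2, dif_pos, h1, Prod.mk.eta, if_true]
  rw [(LinearEquiv.ofBijective Φ hΦ).finrank_eq, Module.finrank_fintype_fun_eq_card,
    Nat.card_eq_fintype_card]

/-- The boundary map from 1-chains to 0-chains. -/
def boundaryQ [Fintype V] : G.chainSpaceQ →ₗ[ℚ] (V → ℚ) where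
  toFun f u := ∑ v, f.1 u v
  map_add' f g := by ext u; simp [Finset.sum_add_distrib]
  map_smul' a f := by ext u; simp [Finset.mul_sum]

theorem bettiOne_eq_finrank_ker [Fintype V] :
    G.bettiOne = Module.finrank ℚ (LinearMap.ker G.boundaryQ) := by
  suffices h : G.cycleSpaceQ = (LinearMap.ker G.boundaryQ).map G.chainSpaceQ.subtype by
    rw [bettiOne, h, Submodule.finrank_map_subtype_eq]
  ext f
  constructor
  · rintro ⟨h1, h2, h3⟩
    refine ⟨⟨f, h1, h2⟩, LinearMap.mem_ker.2 (funext fun u => ?_), rfl⟩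
    exact (finsum_eq_sum_of_fintype _).symm.trans (h3 u)
  · rintro ⟨⟨f, h1, h2⟩, h3, rfl⟩
    refine ⟨h1, h2, fun u => ?_⟩
    exact (finsum_eq_sum_of_fintype _).trans (congrFun (LinearMap.mem_ker.1 h3) u)

theorem Connected.single_sub_single_mem_range_boundaryQ [Fintype V] [DecidableEq V] {G : SimpleGraph V}
    (hG : G.Connected) (u v : V) :
    (Pi.single u 1 - Pi.single v 1 : V → ℚ) ∈ LinearMap.range G.boundaryQ := by
  obtain ⟨w⟩ := hG.preconnected u v
  induction w with
  | nil => simp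
  | @cons u v w h _ ih =>
    rw [← sub_add_sub_cancel _ (Pi.single v 1 : V → ℚ)]
    refine Submodule.add_mem _ ?_ ih
    refine ⟨⟨fun a b => (Pi.single u 1 : V → ℚ) a * (Pi.single v 1 : V → ℚ) b -
      (Pi.single v 1 : V → ℚ) a * (Pi.single u 1 : V → ℚ) b, fun a b => by ring, ?_⟩, ?_⟩
    · intro a b hab
      have h1 : ¬ (a = u ∧ b = v) := by
        rintro ⟨rfl, rfl⟩
        exact hab h
      have h2 : ¬ (a = v ∧ b = u) := by
        rintro ⟨rfl, rfl⟩
        exact hab h.symm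
      simp only [Pi.single_apply, ← ite_and, mul_ite, mul_one, mul_zero]
      rw [if_neg (fun h => h1 h.symm), if_neg (fun h => h2 h.symm), sub_zero]
    · funext a
      simp [boundaryQ, Finset.sum_sub_distrib, ← Finset.mul_sum]

theorem Connected.bettiOne_add_card [Finite V] {G : SimpleGraph V} (hG : G.Connected) :
    G.bettiOne + Nat.card V = Nat.card G.edgeSet + 1 := by
  classical
  have := Fintype.ofFinite V
  obtain ⟨u₀⟩ := hG.nonempty
  let σ : (V → ℚ) →ₗ[ℚ] ℚ := ∑ v, LinearMap.proj v
  have hσ : ∀ f, σ f = ∑ v, f v := fun f => by simp [σ]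
  -- By connectedness the boundaries are exactly the 0-chains with total zero, a subspace of
  -- codimension one; rank-nullity does the rest.
  have hr : LinearMap.range G.boundaryQ = LinearMap.ker σ := by
    apply le_antisymm
    · rintro _ ⟨⟨f, h1, h2⟩, rfl⟩
      rw [LinearMap.mem_ker, hσ]
      have h3 : ∑ u, ∑ v, f u v = - ∑ u, ∑ v, f u v := by
        conv_lhs => rw [Finset.sum_comm]
        rw [← Finset.sum_neg_distrib]
        refine Finset.sum_congr rfl fun u _ => ?_
        rw [← Finset.sum_neg_distrib]
        exact Finset.sum_congr rfl fun v _ => h1 v u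
      change ∑ u, ∑ v, f u v = 0
      linarith
    · intro h hh
      rw [LinearMap.mem_ker, hσ] at hh
      have : h = ∑ u, h u • (Pi.single u 1 - Pi.single u₀ 1 : V → ℚ) := by
        simp only [smul_sub, Finset.sum_sub_distrib, ← Finset.sum_smul, hh, zero_smul, sub_zero]
        funext a
        simp [Finset.sum_apply, Pi.single_apply]
      rw [this]
      exact Submodule.sum_mem _ fun u _ => Submodule.smul_mem _ _
        (hG.single_sub_single_mem_range_boundaryQ u u₀)
  have hs : LinearMap.range σ = ⊤ := by
    rw [LinearMap.range_eq_top]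
    intro q
    exact ⟨Pi.single u₀ q, by simp [hσ]⟩
  have h1 := LinearMap.finrank_range_add_finrank_ker G.boundaryQ
  have h2 := LinearMap.finrank_range_add_finrank_ker σ
  rw [hs, finrank_top, Module.finrank_self, Module.finrank_fintype_fun_eq_card,
    ← Nat.card_eq_fintype_card] at h2
  rw [← bettiOne_eq_finrank_ker, hr, finrank_chainSpaceQ] at h1
  omega

end SimpleGraph

/-! ## The reduced `A`-graph of a knot diagram -/

namespace LinkDiagram

open Relation

variable {X : Type*} {D : LinkDiagram X}

open Classical in
theorem IsAAdequate.card_edgeSet_reducedAGraph [Fintype X] (ha : D.IsAAdequate) :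
    Nat.card D.reducedAGraph.edgeSet = (Finset.univ.image D.aEdge).card := by
  have h : D.reducedAGraph.edgeSet = ↑(Finset.univ.image D.aEdge) := by
    ext e
    induction e using Sym2.ind with
    | h u v =>
      simp only [SimpleGraph.mem_edgeSet, Finset.coe_image, Finset.coe_univ, Set.image_univ,
        Set.mem_range]
      constructor
      · rintro ⟨-, x, hx⟩
        exact ⟨x, Eq.symm hx⟩
      · rintro ⟨x, hx⟩
        refine ⟨?_, x, Eq.symm hx⟩
        rintro rfl
        exact ha.not_isLoopAt x u (Eq.symm hx)
  rw [h]
  exact (Nat.card_eq_fintype_card).trans (Fintype.card_coe _)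

theorem IsKnotDiagram.loops_eq_zero [Finite X] [Nonempty X] (h : D.IsKnotDiagram) : D.loops = 0 := by
  have h1 := h.2
  change Nat.card (Quot _ ⊕ Fin D.loops) = 1 at h1
  rw [Nat.card_sum, Nat.card_fin] at h1
  have : 0 < Nat.card (Quot fun d e : X × Fin 4 => e = D.edge d ∨ e = (d.1, d.2 + 2)) :=
    Nat.card_pos_iff.2 ⟨⟨Quot.mk _ (Classical.arbitrary X, 0)⟩, inferInstance⟩
  omega

/-- Going straight across a crossing changes the A-circle at most to the other one at that crossing,
which is adjacent. So components of the link map onto components of the graph. -/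
theorem IsKnotDiagram.connected_reducedAGraph (h : D.IsKnotDiagram) :
    D.reducedAGraph.Connected := by
  obtain ⟨h1, h2⟩ := Nat.card_eq_one_iff_unique.1 h.2
  have h02 : ∀ x, D.reducedAGraph.connectedComponentMk (D.circleAt (fun _ => true) (x, 0)) =
      D.reducedAGraph.connectedComponentMk (D.circleAt (fun _ => true) (x, 2)) := by
    intro x
    by_cases hx : D.circleAt (fun _ => true) (x, 0) = D.circleAt (fun _ => true) (x, 2)
    · rw [hx]
    · exact SimpleGraph.ConnectedComponent.sound
        (SimpleGraph.Adj.reachable (⟨hx, x, rfl⟩ : D.reducedAGraph.Adj _ _))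
  have hA : ∀ x i, D.circleAt (fun _ => true) (x, i) =
      D.circleAt (fun _ => true) (x, splice true i) :=
    fun x i => circleAt_eq_iff.2 (sameCircle_splice' rfl i)
  let f : D.LinkComponent → D.reducedAGraph.ConnectedComponent :=
    Sum.elim (Quot.lift (fun d => D.reducedAGraph.connectedComponentMk
      (D.circleAt (fun _ => true) d)) (by
        rintro ⟨x, i⟩ e (rfl | rfl)
        · rw [circleAt_eq_iff.2 (sameCircle_edge (fun _ => true) (x, i))]
        · have h1 : D.circleAt (fun _ => true) (x, 0) = D.circleAt (fun _ => true) (x, 1) := hA x 0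
          have h3 : D.circleAt (fun _ => true) (x, 2) = D.circleAt (fun _ => true) (x, 3) := hA x 2
          have h4 := h02 x
          fin_cases i
          · exact h4
          · exact h3 ▸ h1 ▸ h4
          · exact h4.symm
          · exact h3 ▸ h1 ▸ h4.symm))
      (fun i => D.reducedAGraph.connectedComponentMk (Sum.inr i))
  have hf : f.Surjective := by
    rintro ⟨q | i⟩
    · induction q using Quot.ind with
      | mk d => exact ⟨Sum.inl (Quot.mk _ d), rfl⟩
    · exact ⟨Sum.inr i, rfl⟩
  have hsub : Subsingleton D.reducedAGraph.ConnectedComponent := hf.subsingleton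
  refine (SimpleGraph.connected_iff _).2 ⟨fun u v =>
    SimpleGraph.ConnectedComponent.exact (Subsingleton.elim _ _), ?_⟩
  obtain ⟨c⟩ := h2.map f
  induction c using SimpleGraph.ConnectedComponent.ind with
  | h v => exact ⟨v⟩

end LinkDiagram

/-! ## Chebyshev polynomials and quantum integers -/

/-- The recursion preserves parity, so the coefficient just below the top vanishes and the next
cable after the m-cable has at most m - 2 strands. -/
theorem Polynomial.Chebyshev.coeff_S (m : ℕ) : (S ℤ m).coeff m = 1 ∧
    ∀ i, m ≤ i + 1 → i ≠ m → (S ℤ m).coeff i = 0 := by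
  induction m using Nat.twoStepInduction with
  | zero =>
    simp only [Nat.cast_zero, S_zero]
    exact ⟨Polynomial.coeff_one_zero, fun i _ hi => by rw [Polynomial.coeff_one, if_neg hi]⟩
  | one =>
    simp only [Nat.cast_one, S_one]
    exact ⟨Polynomial.coeff_X_one, fun i _ hi => by rw [Polynomial.coeff_X, if_neg hi.symm]⟩
  | more m ih1 ih2 =>
    have h : S ℤ ((m + 2 : ℕ) : ℤ) = Polynomial.X * S ℤ ((m + 1 : ℕ) : ℤ) - S ℤ m := by
      push_cast
      exact S_add_two ℤ m
    rw [h]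
    constructor
    · rw [Polynomial.coeff_sub, Polynomial.coeff_X_mul, ih2.1, ih1.2 _ (by omega) (by omega),
        sub_zero]
    · rintro (_ | i) h1 h2
      · omega
      · rw [Polynomial.coeff_sub, Polynomial.coeff_X_mul, ih2.2 _ (by omega) (by omega),
          ih1.2 _ (by omega) (by omega), sub_zero]

namespace RatFunc

variable {f : RatFunc ℚ} {k : ℤ}

theorem inv_mem_degLT (h : f ∉ degLT k) : f⁻¹ ∈ degLT (1 - k) := by
  intro _
  rw [mem_degLT] at h
  push Not at h
  rw [intDegree_inv]
  omega

theorem X_zpow_notMem_degLT (k : ℤ) : (X ^ k : RatFunc ℚ) ∉ degLT k := fun h => by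
  have := h (zpow_ne_zero _ RatFunc.X_ne_zero)
  rw [intDegree_X_zpow] at this
  omega

theorem X_zpow_sub_X_zpow_notMem_degLT {j : ℤ} (h : j < k) :
    (X ^ k - X ^ j : RatFunc ℚ) ∉ degLT k := fun h' =>
  X_zpow_notMem_degLT k (by simpa using (degLT k).add_mem h' (X_zpow_mem_degLT h))

theorem X_zpow_sub_X_zpow_ne_zero {j : ℤ} (h : j < k) : (X ^ k - X ^ j : RatFunc ℚ) ≠ 0 :=
  fun h' => X_zpow_sub_X_zpow_notMem_degLT h (h' ▸ (degLT k).zero_mem)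

theorem loopValue_notMem_degLT : (-X ^ (2 : ℤ) - X ^ (-2 : ℤ) : RatFunc ℚ) ∉ degLT 2 := fun h =>
  X_zpow_notMem_degLT 2 (by
    have := (degLT 2).neg_mem ((degLT 2).add_mem h (X_zpow_mem_degLT (j := -2) (by norm_num)))
    simpa using this)

theorem loopValue_ne_zero : (-X ^ (2 : ℤ) - X ^ (-2 : ℤ) : RatFunc ℚ) ≠ 0 := fun h =>
  loopValue_notMem_degLT (h ▸ (degLT 2).zero_mem)

end RatFunc

theorem isEmpty_quot {α : Type*} [IsEmpty α] (r : α → α → Prop) : IsEmpty (Quot r) :=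
  ⟨fun q => by
    induction q using Quot.ind with
    | mk a => exact isEmptyElim a⟩

namespace LinkDiagram

open RatFunc

theorem quantumInt_ne_zero (m : ℕ) : quantumInt (m + 1) ≠ 0 :=
  div_ne_zero (X_zpow_sub_X_zpow_ne_zero (by push_cast; omega))
    (X_zpow_sub_X_zpow_ne_zero (by norm_num))

theorem quantumInt_two : quantumInt 2 = -(-RatFunc.X ^ (2 : ℤ) - RatFunc.X ^ (-2 : ℤ)) := by
  have hX : (RatFunc.X : RatFunc ℚ) ≠ 0 := RatFunc.X_ne_zero
  rw [quantumInt, div_eq_iff (X_zpow_sub_X_zpow_ne_zero (by norm_num))]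
  have e1 : (RatFunc.X : RatFunc ℚ) ^ (2 * (2 : ℕ) : ℤ) =
      RatFunc.X ^ (2 : ℤ) * RatFunc.X ^ (2 : ℤ) := by rw [← zpow_add₀ hX]; norm_num
  have e2 : (RatFunc.X : RatFunc ℚ) ^ (-(2 * (2 : ℕ)) : ℤ) =
      RatFunc.X ^ (-2 : ℤ) * RatFunc.X ^ (-2 : ℤ) := by rw [← zpow_add₀ hX]; norm_num
  rw [e1, e2]
  ring

/-- The remainder after A^(2-2m) lies at least eight degrees lower, so this factor leaves the second
coefficient untouched. For m = 0 it would not: [2]/[1] = A² + A⁻². -/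
theorem expands_quantumInt_div {m : ℕ} (hm : 1 ≤ m) :
    Expands (quantumInt 2 / quantumInt (m + 1)) (2 - 2 * m) 1 0 := by
  have hX : (RatFunc.X : RatFunc ℚ) ≠ 0 := RatFunc.X_ne_zero
  set N : RatFunc ℚ := RatFunc.X ^ (2 * m + 2 : ℤ) - RatFunc.X ^ (-(2 * m + 2) : ℤ) with hN
  have hN1 : N ∉ degLT (2 * m + 2) := X_zpow_sub_X_zpow_notMem_degLT (by omega)
  have hN0 : N ≠ 0 := fun h => hN1 (h ▸ (degLT _).zero_mem)
  have h1 : quantumInt 2 / quantumInt (m + 1) =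
      (RatFunc.X ^ (4 : ℤ) - RatFunc.X ^ (-4 : ℤ)) / N := by
    rw [quantumInt, quantumInt, div_div_div_cancel_right₀ (X_zpow_sub_X_zpow_ne_zero (by norm_num))]
    have e1 : 2 * ((m + 1 : ℕ) : ℤ) = 2 * m + 2 := by push_cast; ring
    have e2 : 2 * ((2 : ℕ) : ℤ) = 4 := by norm_num
    rw [e1, e2]
  have h2 : quantumInt 2 / quantumInt (m + 1) - RatFunc.X ^ (2 - 2 * m : ℤ) =
      (RatFunc.X ^ (-(4 * m) : ℤ) - RatFunc.X ^ (-4 : ℤ)) * N⁻¹ := by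
    rw [h1, eq_mul_inv_iff_mul_eq₀ hN0, sub_mul, div_mul_cancel₀ _ hN0, hN, mul_sub,
      ← zpow_add₀ hX, ← zpow_add₀ hX]
    ring_nf
  rw [Expands]
  simp only [Int.cast_one, one_mul, Int.cast_zero, zero_mul, add_zero]
  rw [h2]
  exact mul_mem_degLT (j := -3) ((degLT _).sub_mem (X_zpow_mem_degLT (by omega))
    (X_zpow_mem_degLT (by norm_num))) (inv_mem_degLT hN1) (by omega)

/-- Used for the crossingless diagram, whose i-cable consists of i circles and has bracket δ^(i-1).
-/
theorem eval_S_loopValue (m : ℕ) :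
    (Polynomial.Chebyshev.S (RatFunc ℚ) m).eval (-RatFunc.X ^ (2 : ℤ) - RatFunc.X ^ (-2 : ℤ)) =
      (-1) ^ m * quantumInt (m + 1) := by
  have hX : (RatFunc.X : RatFunc ℚ) ≠ 0 := RatFunc.X_ne_zero
  have hw : (RatFunc.X ^ (2 : ℤ) - RatFunc.X ^ (-2 : ℤ) : RatFunc ℚ) ≠ 0 :=
    X_zpow_sub_X_zpow_ne_zero (by norm_num)
  induction m using Nat.twoStepInduction with
  | zero =>
    have e : 2 * ((0 + 1 : ℕ) : ℤ) = 2 := by norm_num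
    rw [Nat.cast_zero, Polynomial.Chebyshev.S_zero, Polynomial.eval_one, pow_zero, one_mul,
      quantumInt, e, div_self hw]
  | one =>
    have := quantumInt_two
    simp only [Nat.cast_one, Polynomial.Chebyshev.S_one, Polynomial.eval_X]
    rw [this]
    ring
  | more m ih1 ih2 =>
    have h : Polynomial.Chebyshev.S (RatFunc ℚ) ((m + 2 : ℕ) : ℤ) =
        Polynomial.X * Polynomial.Chebyshev.S (RatFunc ℚ) ((m + 1 : ℕ) : ℤ) -
          Polynomial.Chebyshev.S (RatFunc ℚ) m := by
      push_cast
      exact Polynomial.Chebyshev.S_add_two _ m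
    rw [h, Polynomial.eval_sub, Polynomial.eval_mul, Polynomial.eval_X, ih1, ih2]
    simp only [quantumInt]
    rw [mul_div_assoc', mul_div_assoc', mul_div_assoc', mul_div_assoc', ← sub_div]
    congr 1
    have e1 : (RatFunc.X : RatFunc ℚ) ^ (2 * ((m + 2 + 1 : ℕ) : ℤ)) =
      RatFunc.X ^ (2 : ℤ) * RatFunc.X ^ (2 * ((m + 1 + 1 : ℕ) : ℤ)) := by
        rw [← zpow_add₀ hX]; congr 1; omega
    have e2 : (RatFunc.X : RatFunc ℚ) ^ (-(2 * ((m + 2 + 1 : ℕ) : ℤ))) =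
      RatFunc.X ^ (-2 : ℤ) * RatFunc.X ^ (-(2 * ((m + 1 + 1 : ℕ) : ℤ))) := by
        rw [← zpow_add₀ hX]; congr 1; omega
    have e3 : (RatFunc.X : RatFunc ℚ) ^ (2 * ((m + 1 : ℕ) : ℤ)) =
      RatFunc.X ^ (-2 : ℤ) * RatFunc.X ^ (2 * ((m + 1 + 1 : ℕ) : ℤ)) := by
        rw [← zpow_add₀ hX]; congr 1; omega
    have e4 : (RatFunc.X : RatFunc ℚ) ^ (-(2 * ((m + 1 : ℕ) : ℤ))) =
      RatFunc.X ^ (2 : ℤ) * RatFunc.X ^ (-(2 * ((m + 1 + 1 : ℕ) : ℤ))) := by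
        rw [← zpow_add₀ hX]; congr 1
    rw [e1, e2, e3, e4]
    ring

theorem exists_unit_eq_neg_one_zpow (z : ℤ) :
    ∃ η : ℤ, |η| = 1 ∧ (-1 : RatFunc ℚ) ^ z = (η : RatFunc ℚ) := by
  rcases Int.even_or_odd z with h | h
  · exact ⟨1, by simp, by rw [h.neg_one_zpow]; simp⟩
  · exact ⟨-1, by simp, by rw [h.neg_one_zpow]; simp⟩

/-! ## The head of the colored Jones polynomial -/

variable {X : Type*} {D : LinkDiagram X}

theorem IsKnotDiagram.bettiOne_reducedAGraph [Fintype X] (h : D.IsKnotDiagram) (ha : D.IsAAdequate)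
    [DecidableEq (Sym2 (D.Circle fun _ => true))] :
    D.reducedAGraph.bettiOne + D.aCircleCount = (Finset.univ.image D.aEdge).card + 1 := by
  have h1 := h.connected_reducedAGraph.bettiOne_add_card
  rw [ha.card_edgeSet_reducedAGraph, card_circle] at h1
  rw [aCircleCount]
  convert h1

theorem IsKnotDiagram.loops_eq_one [IsEmpty X] (h : D.IsKnotDiagram) : D.loops = 1 := by
  have h1 := h.2
  change Nat.card (Quot _ ⊕ Fin D.loops) = 1 at h1
  have : IsEmpty (Quot fun d e : X × Fin 4 => e = D.edge d ∨ e = (d.1, d.2 + 2)) :=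
    isEmpty_quot _
  rwa [Nat.card_sum, Nat.card_of_isEmpty, Nat.card_fin, zero_add] at h1

variable [Fintype X] [DecidableEq X]

theorem bracket_of_isEmpty [IsEmpty X] : D.bracket =
    (-RatFunc.X ^ (2 : ℤ) - RatFunc.X ^ (-2 : ℤ)) ^ ((D.loops : ℤ) - 1) := by
  rw [bracket_eq_sum, Fintype.sum_unique, Finset.eq_empty_of_isEmpty (default : Finset X)]
  simp

theorem chebyshevBracket_eq_sum (m : ℕ) : D.chebyshevBracket m = ∑ i ∈ Finset.range (m + 1),
    ((Polynomial.Chebyshev.S ℤ m).coeff i : RatFunc ℚ) * (D.cable i).bracket := by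
  rw [chebyshevBracket, Polynomial.sum_over_range' _ _ (m + 1)]
  · refine Nat.lt_succ_of_le (Polynomial.natDegree_le_iff_coeff_eq_zero.2 fun i hi => ?_)
    exact (Polynomial.Chebyshev.coeff_S m).2 i (by omega) (by omega)
  · simp

open Classical in
/-- The first two coefficients of `⟨Sₘ(D)⟩`. -/
theorem IsKnotDiagram.expands_chebyshevBracket [Nonempty X] (h : D.IsKnotDiagram)
    (ha : D.IsAAdequate) (m : ℕ) :
    ∃ ε k : ℤ, |ε| = 1 ∧ Expands (D.chebyshevBracket (m + 1)) k ε
      (ε * ((D.aCircleCount : ℤ) - 1 - (Finset.univ.image D.aEdge).card)) := by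
  have hD := h.1.isHomPlanar
  obtain ⟨c, hc⟩ := hD.exists_isCheckerboard
  obtain ⟨ε, hε, hexp⟩ := (h.1.isHomPlanar_cable (n := m)).expands_bracket (hc.isAAdequate_cable ha)
  have hcard : ∀ i, Nat.card (X × Fin i × Fin i) = Nat.card X * i ^ 2 := fun i => by
    rw [Nat.card_prod, Nat.card_prod, Nat.card_eq_fintype_card (α := Fin i), Fintype.card_fin]
    ring
  have hv : D.aCircleCount = D.circleCount fun _ => true := by
    rw [aCircleCount, h.loops_eq_zero, add_zero]
  have hv0 : 0 < D.aCircleCount := hv ▸ circleCount_pos _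
  have hx0 : 0 < Nat.card X := Nat.card_pos
  rw [hcard, hc.aCircleCount_cable, hD.card_image_aEdge_cable ha, ← hv] at hexp
  refine ⟨ε, ((Nat.card X * (m + 1) ^ 2 : ℕ) : ℤ) + 2 * ((m + 1) * D.aCircleCount : ℕ) - 2, hε, ?_⟩
  have hlow : ∑ i ∈ Finset.range (m + 1),
      ((Polynomial.Chebyshev.S ℤ (m + 1 : ℕ)).coeff i : RatFunc ℚ) * (D.cable i).bracket ∈
        degLT (((Nat.card X * (m + 1) ^ 2 : ℕ) : ℤ) + 2 * ((m + 1) * D.aCircleCount : ℕ) - 2 - 4) := by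
    refine (degLT _).sum_mem fun i hi => ?_
    rcases Nat.lt_succ_iff_lt_or_eq.1 (Finset.mem_range.1 hi) with hi | rfl
    · refine mul_mem_degLT (intCast_mem_degLT _ one_pos) (k := ((Nat.card X * (m + 1) ^ 2 : ℕ) : ℤ) +
        2 * ((m + 1) * D.aCircleCount : ℕ) - 2 - 4) ?_ (by omega)
      rcases i with _ | i
      · rw [bracket_of_isEmpty]
        have hl : (D.cable 0).loops = 0 := zero_mul _
        rw [hl, Nat.cast_zero, zero_sub, zpow_neg_one]
        refine degLT_mono ?_ (inv_mem_degLT loopValue_notMem_degLT)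
        push_cast
        nlinarith
      · obtain ⟨c', hc'⟩ := (h.1.isHomPlanar_cable (n := i)).exists_isCheckerboard
        refine degLT_mono ?_ hc'.bracket_mem_degLT
        rw [hcard, hc.aCircleCount_cable]
        obtain ⟨j, rfl⟩ := Nat.exists_eq_add_of_lt hi
        -- This product is (m + 1)² - (i + 1)², the number by which the crossings over one crossing
        -- of `D` exceed those in the lower cable.
        have p1 : (8 : ℤ) ≤ (j + 2) * (2 * i + j + 4) := by nlinarith
        have p2 : ((j : ℤ) + 2) * (2 * i + j + 4) ≤ Nat.card X * ((j + 2) * (2 * i + j + 4)) :=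
          le_mul_of_one_le_left (by omega) (by omega)
        have p3 : (j : ℤ) + 2 ≤ D.aCircleCount * (j + 2) :=
          le_mul_of_one_le_left (by omega) (by omega)
        push_cast
        nlinarith
    · rw [(Polynomial.Chebyshev.coeff_S _).2 i (by omega) (by omega), Int.cast_zero, zero_mul]
      exact (degLT _).zero_mem
  rw [chebyshevBracket_eq_sum, Finset.sum_range_succ, (Polynomial.Chebyshev.coeff_S _).1,
    Int.cast_one, one_mul, add_comm]
  convert hexp.add (expands_of_mem_degLT hlow) using 1
  · ring
  · push_cast
    ring

/-- The writhe enters only through a signed power of A, so it affects neither absolute value. -/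
theorem normalizedColoredJonesSucc_eq (m : ℕ) : ∃ η j : ℤ, |η| = 1 ∧
    D.normalizedColoredJonesSucc m = (η : RatFunc ℚ) * RatFunc.X ^ j *
      (quantumInt 2 / quantumInt (m + 1)) * D.chebyshevBracket m := by
  obtain ⟨η₁, h1, h1'⟩ := exists_unit_eq_neg_one_zpow (m * -D.writhe)
  obtain ⟨η₂, h2, h2'⟩ := exists_unit_eq_neg_one_zpow ((m : ℤ) - 1)
  refine ⟨η₁ * η₂, ((m ^ 2 + 2 * m : ℕ) : ℤ) * -D.writhe, by rw [abs_mul, h1, h2, one_mul], ?_⟩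
  rw [normalizedColoredJonesSucc, coloredJonesSucc, mul_zpow, h2', ← zpow_natCast (-1) m,
    ← zpow_mul, h1', ← zpow_natCast RatFunc.X, ← zpow_mul]
  push_cast
  ring

theorem IsKnotDiagram.chebyshevBracket_of_isEmpty [IsEmpty X] (h : D.IsKnotDiagram) (m : ℕ) :
    quantumInt 2 * D.chebyshevBracket m = (-1) ^ (m + 1) * quantumInt (m + 1) := by
  have hδ := loopValue_ne_zero
  rw [quantumInt_two]
  have h1 : D.chebyshevBracket m = (Polynomial.Chebyshev.S (RatFunc ℚ) m).eval
      (-RatFunc.X ^ (2 : ℤ) - RatFunc.X ^ (-2 : ℤ)) /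
        (-RatFunc.X ^ (2 : ℤ) - RatFunc.X ^ (-2 : ℤ)) := by
    rw [← Polynomial.Chebyshev.map_S (Int.castRingHom (RatFunc ℚ)), Polynomial.eval_map,
      Polynomial.eval₂_eq_sum, chebyshevBracket, Polynomial.sum, Polynomial.sum, Finset.sum_div]
    refine Finset.sum_congr rfl fun i _ => ?_
    have hl : (D.cable i).loops = i := by
      change i * D.loops = i
      rw [h.loops_eq_one, mul_one]
    rw [bracket_of_isEmpty, hl, zpow_sub_one₀ hδ, zpow_natCast, eq_intCast]
    ring
  rw [h1, neg_mul, mul_div_cancel₀ _ hδ, eval_S_loopValue]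
  ring

/-- The normalized colored Jones polynomial of a knot diagram without crossings. -/
theorem IsKnotDiagram.normalizedColoredJonesSucc_of_isEmpty [IsEmpty X] (h : D.IsKnotDiagram)
    (m : ℕ) : ∃ η : ℤ, |η| = 1 ∧ D.normalizedColoredJonesSucc m = (η : RatFunc ℚ) := by
  obtain ⟨η, h1, h2⟩ := exists_unit_eq_neg_one_zpow ((m : ℤ) - 1)
  refine ⟨η * (-1) ^ (m + 1), by simp [abs_mul, h1], ?_⟩
  have hw : D.writhe = 0 := Finset.sum_of_isEmpty _
  rw [normalizedColoredJonesSucc, coloredJonesSucc, hw, neg_zero, zpow_zero, one_mul, h2, mul_assoc,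
    h.chebyshevBracket_of_isEmpty, div_eq_iff (quantumInt_ne_zero m)]
  push_cast
  ring

end LinkDiagram

/-- For an `A`-adequate knot diagram `D` and every color `n = m + 1 ≥ 2`,
`J'_D(n) = a A^k + b A^(k-4) + (terms of degree less than k - 4)` with `|a| = 1` and
`|b| = β₁(A(D)')`. -/
theorem mainTheorem3 {X : Type*} [Fintype X] [DecidableEq X] (D : LinkDiagram X)
    (hknot : D.IsKnotDiagram) (hadequate : D.IsAAdequate) (m : ℕ) (hm : 1 ≤ m) :
    ∃ (a b k : ℤ) (R : RatFunc ℚ),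
      D.normalizedColoredJonesSucc m =
        (a : RatFunc ℚ) * RatFunc.X ^ k + (b : RatFunc ℚ) * RatFunc.X ^ (k - 4) + R ∧
      (R ≠ 0 → R.intDegree < k - 4) ∧
      |a| = 1 ∧ |b| = (D.reducedAGraph.bettiOne : ℤ) := by
  classical
  have hβ := hknot.bettiOne_reducedAGraph hadequate
  rcases isEmpty_or_nonempty X with hX | hX
  · obtain ⟨η, hη, hJ⟩ := hknot.normalizedColoredJonesSucc_of_isEmpty m
    have h1 : D.aCircleCount = 1 := by
      have : IsEmpty (Quot (D.stateRel fun _ => true)) :=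
        isEmpty_quot _
      rw [LinkDiagram.aCircleCount, hknot.loops_eq_one, LinkDiagram.circleCount,
        Nat.card_of_isEmpty]
    refine ⟨η, 0, 0, 0, by simp [hJ], fun h => absurd rfl h, hη, ?_⟩
    simp only [Finset.univ_eq_empty, Finset.image_empty, Finset.card_empty] at hβ
    rw [abs_zero]
    omega
  · obtain ⟨m, rfl⟩ := Nat.exists_eq_add_of_le' hm
    obtain ⟨ε, k, hε, hexp⟩ := hknot.expands_chebyshevBracket hadequate m
    obtain ⟨η, j, hη, hJ⟩ := D.normalizedColoredJonesSucc_eq (m + 1)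
    have key := (((RatFunc.expands_intCast η).mul (RatFunc.expands_X_zpow j)).mul
      (LinkDiagram.expands_quantumInt_div hm)).mul hexp
    rw [← hJ] at key
    refine ⟨_, _, _, _, (add_sub_cancel _ _).symm, key, ?_, ?_⟩
    · simp [abs_mul, hη, hε]
    · have : (D.aCircleCount : ℤ) - 1 - (Finset.univ.image D.aEdge).card =
          -D.reducedAGraph.bettiOne := by omega
      rw [this]
      simp [abs_mul, hη, hε]
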